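/- Let $\mathcal H=\ell^2(\mathbb N)$ be the Hilbert space of one harmonic oscillator, with Fock basis $(|n\rangle)_{n\ge 0}$ and ladder operator $\hat a|n\rangle=\sqrt n\,|n-1\rangle$. Let $\hat b$ be the ladder operator of a second mode $B$ with vacuum $|0\rangle_B$. For $0\le\lambda\le1$ let $$\hat U_\lambda=\exp\left(\left(\hat a^\dagger\hat b-\hat a\,\hat b^\dagger\right)\arccos\sqrt\lambda\right),\qquad \Phi_\lambda(\hat\rho)=\mathrm{Tr}_B\left[\hat U_\lambda\left(\hat\rho\otimes|0\rangle_B\langle0|\right)\hat U_\lambda^\dagger\right]$$ be the quantum-limited attenuator of transmissivity $\lambda$. Let $S(\hat\rho)=-\mathrm{Tr}[\hat\rho\ln\hat\rho]$ be the von Neumann entropy, and for $E\ge0$ let $g(E)=(E+1)\ln(E+1)-E\ln E$ (with $0\ln0=0$), which is a bijection of $[0,\infty)$ onto itself. Let $$f(S)=-g^{-1}(S)\,g'\left(g^{-1}(S)\right)\quad(S>0),\qquad f(0)=\lim_{S\to0}f(S)=0.$$ **Theorem (isoperimetric inequality).** Let $\hat\rho$ be a quantum state on $\mathcal H$ (a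 positive operator of trace one) with finite support, i.e. supported on the span of $|0\rangle,\dots,|N\rangle$ for some $N\in\mathbb N$. Then $S(\Phi_{e^{-t}}(\hat\rho))$ is finite for every $t\ge0$, the right derivative of $t\mapsto S(\Phi_{e^{-t}}(\hat\rho))$ at $t=0$ exists as an extended real number (it may equal $+\infty$), and $$\left.\frac{d}{dt}S\left(\Phi_{e^{-t}}(\hat\rho)\right)\right|_{t=0}\ \ge\ f\left(S(\hat\rho)\right).$$ -/

import Mathlib

open Filter Topology
open scoped InnerProductSpace lp

noncomputable section

namespace Attenuator

/-! ### Fock space -/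

/-- The basis vector `|x⟩` of `ℓ²(ι, ℂ)`.  For `ι = ℕ` these are the Fock states `|n⟩` of one mode;
for `ι = ℕ × ℕ` they are the product Fock states `|n⟩ ⊗ |m⟩` of the two modes `A` and `B`, where
`ℓ²(ℕ × ℕ, ℂ)` is the Hilbert tensor product of `ℓ²(ℕ, ℂ)` with itself. -/
def ket {ι : Type} [DecidableEq ι] (x : ι) : ℓ²(ι, ℂ) :=
  lp.single 2 x (1 : ℂ)

theorem orthonormal_ket {ι : Type} [DecidableEq ι] :
    Orthonormal ℂ (ket : ι → ℓ²(ι, ℂ)) := by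
  rw [orthonormal_iff_ite]
  intro i j
  rw [ket, lp.inner_single_left]
  simp [ket, lp.single_apply, Pi.single_apply]

/-- The isometry of Hilbert spaces which sends `|x⟩` to `v x`, for an orthonormal family `v`. -/
def isometryOf {ι : Type} {H : Type} [NormedAddCommGroup H] [InnerProductSpace ℂ H]
    [CompleteSpace H] {v : ι → H} (hv : Orthonormal ℂ v) : ℓ²(ι, ℂ) →ₗᵢ[ℂ] H :=
  hv.orthogonalFamily.linearIsometry

theorem isometryOf_ket {ι : Type} [DecidableEq ι] {H : Type} [NormedAddCommGroup H]
    [InnerProductSpace ℂ H] [CompleteSpace H] {v : ι → H} (hv : Orthonormal ℂ v) (x : ι) :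
    isometryOf hv (ket x) = v x := by
  simp [isometryOf, ket]

/-! ### Ladder operators and the beamsplitter

The ladder operators are unbounded; they act on the vectors with finitely many non-zero
coordinates in the product Fock basis, i.e. on `(ℕ × ℕ) →₀ ℂ`. -/

/-- `a ⊗ 1`, with `a |n⟩ = √n |n - 1⟩`. -/
def annA : ((ℕ × ℕ) →₀ ℂ) →ₗ[ℂ] ((ℕ × ℕ) →₀ ℂ) :=
  Finsupp.linearCombination ℂ fun x => Finsupp.single (x.1 - 1, x.2) (Real.sqrt x.1 : ℂ)

/-- `a† ⊗ 1`, with `a† |n⟩ = √(n + 1) |n + 1⟩`. -/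
def creA : ((ℕ × ℕ) →₀ ℂ) →ₗ[ℂ] ((ℕ × ℕ) →₀ ℂ) :=
  Finsupp.linearCombination ℂ fun x => Finsupp.single (x.1 + 1, x.2) (Real.sqrt (x.1 + 1) : ℂ)

/-- `1 ⊗ b`. -/
def annB : ((ℕ × ℕ) →₀ ℂ) →ₗ[ℂ] ((ℕ × ℕ) →₀ ℂ) :=
  Finsupp.linearCombination ℂ fun x => Finsupp.single (x.1, x.2 - 1) (Real.sqrt x.2 : ℂ)

/-- `1 ⊗ b†`. -/
def creB : ((ℕ × ℕ) →₀ ℂ) →ₗ[ℂ] ((ℕ × ℕ) →₀ ℂ) :=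
  Finsupp.linearCombination ℂ fun x => Finsupp.single (x.1, x.2 + 1) (Real.sqrt (x.2 + 1) : ℂ)

/-- The generator `a† b - a b†`. -/
def generator : ((ℕ × ℕ) →₀ ℂ) →ₗ[ℂ] ((ℕ × ℕ) →₀ ℂ) :=
  creA * annB - annA * creB

/-- A finitely supported family of coefficients, seen as a vector of the Hilbert space. -/
def toHilbert : ((ℕ × ℕ) →₀ ℂ) →ₗ[ℂ] ℓ²(ℕ × ℕ, ℂ) :=
  Finsupp.linearCombination ℂ ket

/-- The vector `exp (θ (a† b - a b†)) |x⟩`, as an exponential series (all of whose terms lie in the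
finite-dimensional space of vectors with the same total photon number as `|x⟩`). -/
def expKet (θ : ℝ) (x : ℕ × ℕ) : ℓ²(ℕ × ℕ, ℂ) :=
  ∑' k : ℕ, (((k.factorial : ℂ)⁻¹) * (θ : ℂ) ^ k) •
    toHilbert ((generator ^ k) (Finsupp.single x 1))

theorem generator_single (n m : ℕ) :
    generator (Finsupp.single (n, m) 1) =
      Finsupp.single (n + 1, m - 1) ((Real.sqrt (n + 1) * Real.sqrt m : ℝ) : ℂ)
        - Finsupp.single (n - 1, m + 1) ((Real.sqrt n * Real.sqrt (m + 1) : ℝ) : ℂ) := by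
  simp [generator, creA, annB, annA, creB, mul_comm]

/-- The product Fock labels with total photon number at most `M`. -/
def lowPhotons (M : ℕ) : Finset (ℕ × ℕ) :=
  (Finset.range (M + 1) ×ˢ Finset.range (M + 1)).filter fun x => x.1 + x.2 ≤ M

theorem mem_lowPhotons {M : ℕ} {x : ℕ × ℕ} : x ∈ lowPhotons M ↔ x.1 + x.2 ≤ M := by
  simp only [lowPhotons, Finset.mem_filter, Finset.mem_product, Finset.mem_range]
  omega

/-- The restriction of the generator to at most `M` photons, as a bounded operator. -/
def truncGenerator (M : ℕ) : ℓ²(ℕ × ℕ, ℂ) →L[ℂ] ℓ²(ℕ × ℕ, ℂ) :=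
  ∑ x ∈ lowPhotons M, InnerProductSpace.rankOne ℂ (toHilbert (generator (Finsupp.single x 1))) (ket x)

theorem truncGenerator_ket {M : ℕ} {x : ℕ × ℕ} (hx : x ∈ lowPhotons M) :
    truncGenerator M (ket x) = toHilbert (generator (Finsupp.single x 1)) := by
  have h := orthonormal_iff_ite.1 (orthonormal_ket (ι := ℕ × ℕ))
  simp [truncGenerator, h, hx]

theorem inner_ket_toHilbert (x : ℕ × ℕ) (f : (ℕ × ℕ) →₀ ℂ) :
    ⟪ket x, toHilbert f⟫_ℂ = f x := by
  have h := orthonormal_iff_ite.1 (orthonormal_ket (ι := ℕ × ℕ))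
  simp only [toHilbert, Finsupp.linearCombination_apply, Finsupp.sum, inner_sum, inner_smul_right,
    h, mul_ite, mul_one, mul_zero]
  simp +contextual

theorem generator_apply (n m p q : ℕ) :
    (generator (Finsupp.single (n, m) 1)) (p, q) =
      (if n + 1 = p ∧ m = q + 1 then ((Real.sqrt (n + 1) * Real.sqrt m : ℝ) : ℂ) else 0)
        - (if n = p + 1 ∧ m + 1 = q then ((Real.sqrt n * Real.sqrt (m + 1) : ℝ) : ℂ) else 0) := by
  rw [generator_single, Finsupp.sub_apply, Finsupp.single_apply, Finsupp.single_apply]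
  congr 1
  · rcases m with _ | m
    · simp
    · simp
  · rcases n with _ | n
    · simp
    · simp

theorem generator_skew (x y : ℕ × ℕ) :
    (generator (Finsupp.single x 1)) y = - (generator (Finsupp.single y 1)) x := by
  obtain ⟨n, m⟩ := x
  obtain ⟨p, q⟩ := y
  rw [generator_apply, generator_apply, neg_sub]
  congr 1
  · by_cases h : n + 1 = p ∧ m = q + 1
    · obtain ⟨rfl, rfl⟩ := h
      simp
    · rw [if_neg h, if_neg (by omega)]
  · by_cases h : n = p + 1 ∧ m + 1 = q
    · obtain ⟨rfl, rfl⟩ := h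
      simp
    · rw [if_neg h, if_neg (by omega)]

theorem generator_conj (x y : ℕ × ℕ) :
    (starRingEnd ℂ) ((generator (Finsupp.single x 1)) y) = (generator (Finsupp.single x 1)) y := by
  obtain ⟨n, m⟩ := x
  obtain ⟨p, q⟩ := y
  rw [generator_apply]
  split_ifs <;> simp

theorem generator_ne_zero {x y : ℕ × ℕ} (h : (generator (Finsupp.single x 1)) y ≠ 0) :
    y.1 + y.2 = x.1 + x.2 := by
  obtain ⟨n, m⟩ := x
  obtain ⟨p, q⟩ := y
  rw [generator_apply] at h
  by_contra hne
  apply h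
  simp only at hne
  rw [if_neg (by omega), if_neg (by omega), sub_zero]

theorem inner_truncGenerator (M : ℕ) (x y : ℕ × ℕ) :
    ⟪ket y, truncGenerator M (ket x)⟫_ℂ =
      if x ∈ lowPhotons M then (generator (Finsupp.single x 1)) y else 0 := by
  have h := orthonormal_iff_ite.1 (orthonormal_ket (ι := ℕ × ℕ))
  split_ifs with hx
  · rw [truncGenerator_ket hx, inner_ket_toHilbert]
  · have : truncGenerator M (ket x) = 0 := by
      simp [truncGenerator, h, hx]
    rw [this, inner_zero_right]

theorem eq_of_inner_ket {ι : Type} [DecidableEq ι] {u v : ℓ²(ι, ℂ)}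
    (h : ∀ x, ⟪ket x, u⟫_ℂ = ⟪ket x, v⟫_ℂ) : u = v := by
  ext x
  have := h x
  simpa [ket, lp.inner_single_left] using this

theorem op_ext_ket {ι : Type} [DecidableEq ι] {H : Type} [NormedAddCommGroup H]
    [InnerProductSpace ℂ H] {S T : ℓ²(ι, ℂ) →L[ℂ] H}
    (h : ∀ x, S (ket x) = T (ket x)) : S = T := by
  ext f
  have hf := lp.hasSum_single (p := 2) (by norm_num) f
  have key : ∀ i, lp.single 2 i (f i) = f i • (ket i : ℓ²(ι, ℂ)) := by
    intro i
    rw [ket, ← lp.single_smul]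
    simp
  simp only [key] at hf
  refine (S.hasSum hf).unique ?_
  convert T.hasSum hf using 2 with i
  simp [h i]

theorem truncGenerator_skew (M : ℕ) : truncGenerator M ∈ skewAdjoint _ := by
  rw [skewAdjoint.mem_iff]
  refine op_ext_ket fun x => eq_of_inner_ket fun y => ?_
  rw [ContinuousLinearMap.star_eq_adjoint, ContinuousLinearMap.adjoint_inner_right,
    ← inner_conj_symm, inner_truncGenerator, neg_apply, inner_neg_right,
    inner_truncGenerator]
  by_cases hz : (generator (Finsupp.single x 1)) y = 0
  · have hz' : (generator (Finsupp.single y 1)) x = 0 := by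
      rw [generator_skew, hz, neg_zero]
    simp [hz, hz']
  · have hM : x ∈ lowPhotons M ↔ y ∈ lowPhotons M := by
      rw [mem_lowPhotons, mem_lowPhotons, generator_ne_zero hz]
    by_cases hx : x ∈ lowPhotons M
    · rw [if_pos hx, if_pos (hM.1 hx), generator_conj, generator_skew]
    · rw [if_neg hx, if_neg (fun h => hx (hM.2 h))]
      simp

theorem truncGenerator_toHilbert {M : ℕ} {f : (ℕ × ℕ) →₀ ℂ} (hf : f.support ⊆ lowPhotons M) :
    truncGenerator M (toHilbert f) = toHilbert (generator f) := by
  have hsum : f = ∑ x ∈ f.support, f x • Finsupp.single x (1 : ℂ) := by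
    conv_lhs => rw [← Finsupp.sum_single f]
    simp [Finsupp.sum]
  rw [hsum]
  simp only [map_sum, map_smul]
  refine Finset.sum_congr rfl fun x hx => ?_
  rw [← truncGenerator_ket (hf hx)]
  simp [toHilbert]

theorem support_generator {M : ℕ} {f : (ℕ × ℕ) →₀ ℂ} (hf : f.support ⊆ lowPhotons M) :
    (generator f).support ⊆ lowPhotons M := by
  intro y hy
  rw [Finsupp.mem_support_iff] at hy
  rw [← Finsupp.sum_single f, Finsupp.sum, map_sum, Finsupp.finsetSum_apply] at hy
  obtain ⟨x, hx, hxy⟩ := Finset.exists_ne_zero_of_sum_ne_zero hy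
  have : Finsupp.single x (f x) = f x • Finsupp.single x (1 : ℂ) := by simp
  rw [this, map_smul, Finsupp.smul_apply, smul_eq_mul] at hxy
  have h1 := generator_ne_zero (right_ne_zero_of_mul hxy)
  have h2 := mem_lowPhotons.1 (hf hx)
  exact mem_lowPhotons.2 (by omega)

theorem truncGenerator_pow {M : ℕ} {x : ℕ × ℕ} (hx : x ∈ lowPhotons M) (k : ℕ) :
    ((generator ^ k) (Finsupp.single x 1)).support ⊆ lowPhotons M ∧
      (truncGenerator M ^ k) (ket x) = toHilbert ((generator ^ k) (Finsupp.single x 1)) := by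
  induction k with
  | zero =>
    refine ⟨?_, by simp [toHilbert]⟩
    intro y hy
    have := Finsupp.support_single_subset hy
    rw [Finset.mem_singleton] at this
    exact this ▸ hx
  | succ k ih =>
    rw [pow_succ' generator, pow_succ' (truncGenerator M), Module.End.mul_apply,
      mul_apply_eq_comp, ih.2, truncGenerator_toHilbert ih.1]
    exact ⟨support_generator ih.1, rfl⟩

theorem hasSum_expKet {M : ℕ} {x : ℕ × ℕ} (hx : x ∈ lowPhotons M) (θ : ℝ) :
    HasSum (fun k : ℕ => (((k.factorial : ℂ)⁻¹) * (θ : ℂ) ^ k) •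
      toHilbert ((generator ^ k) (Finsupp.single x 1)))
      (NormedSpace.exp ((θ : ℂ) • truncGenerator M) (ket x)) := by
  have h := NormedSpace.exp_series_hasSum_exp' (𝕂 := ℂ) ((θ : ℂ) • truncGenerator M)
  have h2 := (ContinuousLinearMap.apply ℂ (ℓ²(ℕ × ℕ, ℂ)) (ket x)).hasSum h
  have heq : (fun k : ℕ => (((k.factorial : ℂ)⁻¹) * (θ : ℂ) ^ k) •
      toHilbert ((generator ^ k) (Finsupp.single x 1))) = fun k : ℕ =>
      (ContinuousLinearMap.apply ℂ (ℓ²(ℕ × ℕ, ℂ)) (ket x))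
        ((k.factorial : ℂ)⁻¹ • ((θ : ℂ) • truncGenerator M) ^ k) := by
    funext k
    rw [← (truncGenerator_pow hx k).2, smul_pow]
    simp [mul_smul]
  rw [heq]
  exact h2

theorem expKet_eq {M : ℕ} {x : ℕ × ℕ} (hx : x ∈ lowPhotons M) (θ : ℝ) :
    expKet θ x = NormedSpace.exp ((θ : ℂ) • truncGenerator M) (ket x) :=
  (hasSum_expKet hx θ).tsum_eq

theorem exp_smul_mem_unitary {H : Type} [NormedAddCommGroup H] [InnerProductSpace ℂ H]
    [CompleteSpace H] {T : H →L[ℂ] H} (hT : T ∈ skewAdjoint (H →L[ℂ] H)) (θ : ℝ) :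
    NormedSpace.exp ((θ : ℂ) • T) ∈ unitary (H →L[ℂ] H) := by
  let _ : NormedAlgebra ℚ (H →L[ℂ] H) := NormedAlgebra.restrictScalars ℚ ℂ (H →L[ℂ] H)
  exact NormedSpace.exp_mem_unitary_of_mem_skewAdjoint (skewAdjoint.smul_mem θ hT)

/-- `exp (θ (a† b - a b†))` maps the product Fock basis to an orthonormal family. -/
theorem orthonormal_expKet (θ : ℝ) : Orthonormal ℂ (expKet θ) := by
  rw [orthonormal_iff_ite]
  intro x y
  obtain ⟨hx, hy⟩ : x ∈ lowPhotons (x.1 + x.2 + y.1 + y.2) ∧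
      y ∈ lowPhotons (x.1 + x.2 + y.1 + y.2) := by
    rw [mem_lowPhotons, mem_lowPhotons]
    omega
  have hU := exp_smul_mem_unitary (truncGenerator_skew (x.1 + x.2 + y.1 + y.2)) θ
  rw [expKet_eq hx, expKet_eq hy, ← ContinuousLinearMap.adjoint_inner_right,
    ← ContinuousLinearMap.star_eq_adjoint, ← mul_apply_eq_comp,
    Unitary.star_mul_self_of_mem hU, one_apply_eq_self]
  exact orthonormal_iff_ite.1 orthonormal_ket x y

/-- The beamsplitter `U_lam = exp ((a† b - a b†) arccos √lam)` of transmissivity `lam`. -/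
def beamsplitter (lam : ℝ) : ℓ²(ℕ × ℕ, ℂ) →L[ℂ] ℓ²(ℕ × ℕ, ℂ) :=
  (isometryOf (orthonormal_expKet (Real.arccos (Real.sqrt lam)))).toContinuousLinearMap

/-! ### The attenuator -/

theorem orthonormal_ket_right (q : ℕ) : Orthonormal ℂ fun n : ℕ => ket (n, q) :=
  orthonormal_ket.comp (fun n : ℕ => (n, q)) fun _ _ h => (Prod.mk.inj h).1

/-- The isometry `ψ ↦ ψ ⊗ |q⟩` from the mode `A` to the two modes `A` and `B`. -/
def tensorKet (q : ℕ) : ℓ²(ℕ, ℂ) →L[ℂ] ℓ²(ℕ × ℕ, ℂ) :=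
  (isometryOf (orthonormal_ket_right q)).toContinuousLinearMap

/-- The operator `ρ ⊗ |0⟩⟨0|` on the two modes `A` and `B`. -/
def tensorVacuum (ρ : ℓ²(ℕ, ℂ) →L[ℂ] ℓ²(ℕ, ℂ)) : ℓ²(ℕ × ℕ, ℂ) →L[ℂ] ℓ²(ℕ × ℕ, ℂ) :=
  tensorKet 0 ∘L ρ ∘L (tensorKet 0).adjoint

/-- The partial trace over the mode `B` of a trace class operator on the two modes, that is
`Tr_B X = ∑ q, (1 ⊗ ⟨q|) X (1 ⊗ |q⟩)`. -/
def partialTraceB (X : ℓ²(ℕ × ℕ, ℂ) →L[ℂ] ℓ²(ℕ × ℕ, ℂ)) : ℓ²(ℕ, ℂ) →L[ℂ] ℓ²(ℕ, ℂ) :=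
  ∑' q : ℕ, (tensorKet q).adjoint ∘L X ∘L tensorKet q

/-- The quantum-limited attenuator of transmissivity `lam`,
`Φ_lam(ρ) = Tr_B[U_lam (ρ ⊗ |0⟩⟨0|) U_lam†]`. -/
def attenuator (lam : ℝ) (ρ : ℓ²(ℕ, ℂ) →L[ℂ] ℓ²(ℕ, ℂ)) : ℓ²(ℕ, ℂ) →L[ℂ] ℓ²(ℕ, ℂ) :=
  partialTraceB (beamsplitter lam ∘L tensorVacuum ρ ∘L (beamsplitter lam).adjoint)

/-! ### States and entropy -/

/-- Quantum states of one mode: positive operators of trace one. -/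
def IsState (ρ : ℓ²(ℕ, ℂ) →L[ℂ] ℓ²(ℕ, ℂ)) : Prop :=
  ρ.IsPositive ∧ HasSum (fun n : ℕ => ⟪ket n, ρ (ket n)⟫_ℂ) 1

/-- `ρ` has finite support (in the Fock basis): its support, the orthogonal complement of its
kernel, lies in the span of finitely many Fock states `|0⟩, …, |N⟩`. -/
def HasFiniteSupport (ρ : ℓ²(ℕ, ℂ) →L[ℂ] ℓ²(ℕ, ℂ)) : Prop :=
  ∃ N : ℕ, (LinearMap.ker ρ.toLinearMap)ᗮ ≤ Submodule.span ℂ (ket '' Set.Iic N)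

/-- The operator `-ρ ln ρ` (with `0 ln 0 = 0`), through the continuous functional calculus. -/
def negMulLogOp {H : Type} [NormedAddCommGroup H] [InnerProductSpace ℂ H] [CompleteSpace H]
    (ρ : H →L[ℂ] H) : H →L[ℂ] H :=
  cfc Real.negMulLog ρ

/-- The von Neumann entropy `S(ρ) = -Tr[ρ ln ρ]` (with `0 ln 0 = 0`), with values in `[0, ∞]`.
For a state `ρ`, the operator `-ρ ln ρ` is positive, so its diagonal entries are non-negative. -/
def vonNeumannEntropy (ρ : ℓ²(ℕ, ℂ) →L[ℂ] ℓ²(ℕ, ℂ)) : ENNReal :=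
  ∑' n : ℕ, ENNReal.ofReal (⟪ket n, negMulLogOp ρ (ket n)⟫_ℂ).re

/-! ### The functions `g` and `f` -/

/-- The entropy `g(E) = (E + 1) ln (E + 1) - E ln E` of the thermal state of average energy `E`. -/
def g (E : ℝ) : ℝ := (E + 1) * Real.log (E + 1) - E * Real.log E

theorem hasDerivAt_g {E : ℝ} (hE : 0 < E) :
    HasDerivAt g (Real.log (E + 1) - Real.log E) E := by
  have h1 : HasDerivAt (fun x : ℝ => x * Real.log x) (Real.log E + 1) E :=
    Real.hasDerivAt_mul_log hE.ne'
  have h2 : HasDerivAt (fun x : ℝ => (x + 1) * Real.log (x + 1)) (Real.log (E + 1) + 1) E := by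
    simpa using (Real.hasDerivAt_mul_log (x := E + 1) (by positivity)).comp_add_const E 1
  exact (h2.sub h1).congr_deriv (by ring)

theorem continuous_g : Continuous g :=
  (Real.continuous_mul_log.comp (continuous_id.add continuous_const)).sub Real.continuous_mul_log

/-- `g` is a bijection of `[0, ∞)`, so that its inverse is defined there. -/
theorem bijOn_g : Set.BijOn g (Set.Ici 0) (Set.Ici 0) := by
  have hmono : StrictMonoOn g (Set.Ici 0) := by
    refine strictMonoOn_of_deriv_pos (convex_Ici 0) continuous_g.continuousOn fun E hE => ?_
    rw [interior_Ici, Set.mem_Ioi] at hE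
    rw [(hasDerivAt_g hE).deriv, sub_pos]
    exact Real.log_lt_log hE (by linarith)
  have h0 : g 0 = 0 := by simp [g]
  refine ⟨fun E hE => ?_, hmono.injOn, fun S hS => ?_⟩
  · have := hmono.monotoneOn (Set.self_mem_Ici) hE hE
    rwa [h0] at this
  · have hS' : (0 : ℝ) ≤ S := hS
    have hbig : S ≤ g (Real.exp S) := by
      have h1 : Real.log (Real.exp S) ≤ Real.log (Real.exp S + 1) :=
        Real.log_le_log (Real.exp_pos S) (by linarith)
      rw [Real.log_exp] at h1
      have h2 := Real.exp_pos S
      simp only [g, Real.log_exp]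
      nlinarith
    obtain ⟨E, hE, hES⟩ := intermediate_value_Icc (Real.exp_pos S).le
      continuous_g.continuousOn (show S ∈ Set.Icc (g 0) (g (Real.exp S)) from ⟨by rwa [h0], hbig⟩)
    exact ⟨E, hE.1, hES⟩

/-- The inverse `g⁻¹ : [0, ∞) → [0, ∞)`. -/
def gInv (S : ℝ) : ℝ := Function.invFunOn g (Set.Ici 0) S

/-- `f(S) = -g⁻¹(S) g'(g⁻¹(S))` for `S ≥ 0`.  At `S = 0`, where `g⁻¹(S) = 0` and the limit of
`-E g'(E)` as `E → 0` is `0`, this formula gives `f 0 = 0`. -/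
def f (S : ℝ) : ℝ := -(gInv S * deriv g (gInv S))

end Attenuator

end

noncomputable section

namespace Attenuator

set_option linter.unusedSectionVars false

/-! ### The classical inequality -/

/-! The attenuator never raises the photon number, so a state on the span of `|0⟩, …, |d - 1⟩` stays
there. On this space it has finitely many Kraus operators, read off from the binomial closed form of
`exp (θ (a† b - a b†)) |n, 0⟩`. Hence `ρ_t = ρ + t L(ρ) + O(t²)`, where `L` is the Lindblad
generator of the cut-off ladder operator `a` (whose sign is immaterial): `attenuator_conjEmbed`,
`isBigO_evolution`.

As `ln ρ` may be singular, the entropy is not differentiated directly. Klein's inequality, used in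
both orders with `Λ = -ln (Q + t²)` in place of `-ln Q`, squeezes the difference quotient between
the values of `Tr[L(ρ) Λ]` for `Q = ρ_t` and `Q = ρ`, up to `o(1)`: `difference_quotient_bounds`.
Let `p i`, `b i` be the eigenvalues and eigenvectors of `ρ`. If `a` maps the support of `ρ` into
itself, both bounds tend to `∑ p i |⟨b j, a b i⟩|² (ln p i - ln p j)`. Otherwise the lower bound
tends to `+∞`, so the derivative is `+∞`.

In the first case order `p` decreasingly. The commutation relation gives `‖a† b j‖² ≤ ‖a b j‖² + 1`,
so the net flow of probability into the levels below `k` is at most `k * p k`, its value for the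
Fock-diagonal state with the same ordered spectrum. Abel summation bounds the entropy production
below by `-∑ (n + 1) p (n + 1) (ln p n - ln p (n + 1))`: `f_le_flow`.

It remains to bound this classical sum by `-f` of the entropy: `sum_mul_log_le_neg_f`. The log-sum
inequality reduces it to the tail sums `T k`, and the tangent to the concave function `-f` at the
entropy, applied at `E = T (k + 1) / p k`, makes the entropy terms telescope. For infinite geometric
distributions these classical steps are equalities. -/

theorem hasDerivAt_add_one_mul_log {E : ℝ} (hE : 0 < E) :
    HasDerivAt (fun x : ℝ => (x + 1) * (Real.log (x + 1) - Real.log x))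
      (Real.log (E + 1) - Real.log E - 1 / E) E := by
  have h1 : HasDerivAt (fun x : ℝ => x + 1) 1 E := (hasDerivAt_id E).add_const 1
  have h2 := (h1.log (by positivity)).sub (Real.hasDerivAt_log hE.ne')
  refine (h1.mul h2).congr_deriv ?_
  have : E + 1 ≠ 0 := by positivity
  simp only [Pi.sub_apply]
  field_simp
  ring

/-- The derivative is `ln (1 + 1/x) - 1/x`, non-positive by `ln u ≤ u - 1`. Since `tangentSlope` is
one minus the inverse of this function, its monotonicity is the concavity of `-f`. -/
theorem antitoneOn_add_one_mul_log :
    AntitoneOn (fun x : ℝ => (x + 1) * (Real.log (x + 1) - Real.log x)) (Set.Ioi 0) := by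
  refine antitoneOn_of_deriv_nonpos (convex_Ioi 0)
    (fun x hx => (hasDerivAt_add_one_mul_log hx).continuousAt.continuousWithinAt) ?_ ?_
  · rw [interior_Ioi]
    exact fun x hx => (hasDerivAt_add_one_mul_log hx).differentiableAt.differentiableWithinAt
  · rw [interior_Ioi]
    intro x hx
    have hx : 0 < x := hx
    rw [(hasDerivAt_add_one_mul_log hx).deriv, ← Real.log_div (by positivity) hx.ne']
    have := Real.log_le_sub_one_of_pos (show 0 < (x + 1) / x by positivity)
    have h2 : (x + 1) / x - 1 = 1 / x := by field_simp; ring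
    linarith

theorem one_le_add_one_mul_log {E : ℝ} (hE : 0 < E) :
    1 ≤ (E + 1) * (Real.log (E + 1) - Real.log E) := by
  have := Real.log_le_sub_one_of_pos (show 0 < E / (E + 1) by positivity)
  rw [Real.log_div hE.ne' (by positivity)] at this
  have h2 : E / (E + 1) - 1 = - (1 / (E + 1)) := by field_simp; ring
  have h3 : 1 / (E + 1) ≤ Real.log (E + 1) - Real.log E := by linarith
  rwa [div_le_iff₀ (by positivity), mul_comm] at h3

/-- The slope at `g E` of the concave function `S ↦ -f S`. -/
def tangentSlope (E : ℝ) : ℝ := 1 - 1 / ((E + 1) * (Real.log (E + 1) - Real.log E))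

/-- The value at `0` of the tangent at `g E` to the concave function `S ↦ -f S`. -/
def tangentValue (E : ℝ) : ℝ :=
  E * (Real.log (E + 1) - Real.log E) - tangentSlope E * g E

theorem tangentSlope_nonneg {E : ℝ} (hE : 0 < E) : 0 ≤ tangentSlope E := by
  have := one_le_add_one_mul_log hE
  rw [tangentSlope, sub_nonneg, div_le_one (by linarith)]
  exact this

/-- Needed only as `E → 0`, for the case of zero entropy, where there is no point of tangency with
`E > 0`. -/
theorem tangentValue_le {E : ℝ} (hE : 0 < E) : tangentValue E ≤ E := by
  have h1 := one_le_add_one_mul_log hE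
  have h2 := tangentSlope_nonneg hE
  have h3 : 0 ≤ Real.log (E + 1) := Real.log_nonneg (by linarith)
  have h4 : tangentValue E = E / (E + 1) - tangentSlope E * Real.log (E + 1) := by
    rw [tangentValue, g]
    have : E * (Real.log (E + 1) - Real.log E) * (1 - tangentSlope E) = E / (E + 1) := by
      rw [tangentSlope]
      have h5 : Real.log (E + 1) - Real.log E ≠ 0 := by
        intro h0
        rw [h0] at h1
        norm_num at h1
      field_simp
      ring
    linear_combination this
  have h5 : E / (E + 1) ≤ E := div_le_self hE.le (by linarith)
  have := mul_nonneg h2 h3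
  linarith

/-- With `φ x = (x + 1) ln ((x + 1) / x)`, the difference `D` of the curve and the linear term has
derivative `(φ x / φ E₀ - 1) / (x + 1)`. As `φ` decreases, `D` rises up to `E₀` and falls
afterwards, so `E₀` is its global maximum. -/
theorem le_tangent {E E₀ : ℝ} (hE : 0 ≤ E) (hE₀ : 0 < E₀) :
    E * (Real.log (E + 1) - Real.log E) ≤ tangentValue E₀ + tangentSlope E₀ * g E := by
  set μ := tangentSlope E₀ with hμ
  set φ : ℝ → ℝ := fun x => (x + 1) * (Real.log (x + 1) - Real.log x) with hφ
  set D : ℝ → ℝ := fun x => x * Real.log (x + 1) - x * Real.log x - μ * g x with hD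
  have hφ0 : 0 < φ E₀ := lt_of_lt_of_le one_pos (one_le_add_one_mul_log hE₀)
  have hder : ∀ x, 0 < x → HasDerivAt D ((φ x / φ E₀ - 1) / (x + 1)) x := by
    intro x hx
    have h1 : HasDerivAt (fun x : ℝ => x + 1) 1 x := (hasDerivAt_id x).add_const 1
    have h2 := (((hasDerivAt_id x).mul (h1.log (by positivity))).sub
      (Real.hasDerivAt_mul_log hx.ne')).sub ((hasDerivAt_g hx).const_mul μ)
    refine h2.congr_deriv ?_
    have h3 : x + 1 ≠ 0 := by positivity
    have h4 : μ = 1 - 1 / φ E₀ := rfl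
    rw [h4]
    have h5 := hφ0.ne'
    simp only [id, hφ] at h5 ⊢
    field_simp
    ring
  have hcont : ContinuousOn D (Set.Ici 0) := by
    refine ContinuousOn.sub (ContinuousOn.sub ?_ Real.continuous_mul_log.continuousOn)
      (continuous_g.continuousOn.const_mul μ)
    refine continuousOn_id.mul (ContinuousOn.log (by fun_prop) fun x hx => ?_)
    have : 0 ≤ x := hx
    positivity
  have hanti := antitoneOn_add_one_mul_log
  have key : D E ≤ D E₀ := by
    rcases le_total E E₀ with h | h
    · refine (monotoneOn_of_deriv_nonneg (convex_Icc 0 E₀)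
        (hcont.mono Set.Icc_subset_Ici_self) ?_ ?_) ⟨hE, h⟩ ⟨hE₀.le, le_rfl⟩ h
      · rw [interior_Icc]
        exact fun x hx => (hder x hx.1).differentiableAt.differentiableWithinAt
      · rw [interior_Icc]
        intro x hx
        rw [(hder x hx.1).deriv]
        have h1 : φ E₀ ≤ φ x := hanti hx.1 hE₀ hx.2.le
        have h2 : 1 ≤ φ x / φ E₀ := (one_le_div hφ0).2 h1
        exact div_nonneg (by linarith) (by linarith [hx.1])
    · refine (antitoneOn_of_deriv_nonpos (convex_Ici E₀)
        (hcont.mono (Set.Ici_subset_Ici.2 hE₀.le)) ?_ ?_) Set.self_mem_Ici h h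
      · rw [interior_Ici]
        exact fun x hx => (hder x (hE₀.trans hx)).differentiableAt.differentiableWithinAt
      · rw [interior_Ici]
        intro x hx
        have hx0 : 0 < x := hE₀.trans hx
        rw [(hder x hx0).deriv]
        have h1 : φ x ≤ φ E₀ := hanti hE₀ hx0 (le_of_lt hx)
        have h2 : φ x / φ E₀ ≤ 1 := (div_le_one hφ0).2 h1
        exact div_nonpos_of_nonpos_of_nonneg (by linarith) (by linarith)
  simp only [hD] at key
  rw [tangentValue]
  linarith

/-- This is `le_tangent` at `E = T / p`, multiplied by `p`. The term `p * g (T / p)` becomes a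
combination of `x ln x` terms that telescopes when `T` and `T + p` are consecutive tail sums. -/
theorem mul_log_div_le_tangent {T p E₀ : ℝ} (hT : 0 ≤ T) (hp : 0 < p) (hE₀ : 0 < E₀) :
    T * (Real.log (T + p) - Real.log T) ≤ tangentValue E₀ * p + tangentSlope E₀ *
      ((T + p) * Real.log (T + p) - T * Real.log T - p * Real.log p) := by
  have h := le_tangent (E := T / p) (by positivity) hE₀
  have h1 : T / p + 1 = (T + p) / p := by field_simp
  rw [g, h1, Real.log_div (by positivity) hp.ne'] at h
  rcases hT.eq_or_lt with rfl | hT0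
  · simp only [zero_div, zero_mul, Real.log_zero, zero_add, sub_self, mul_zero, add_zero,
      sub_zero] at h ⊢
    have := mul_le_mul_of_nonneg_right h hp.le
    simpa using this
  · rw [Real.log_div hT0.ne' hp.ne'] at h
    have := mul_le_mul_of_nonneg_right h hp.le
    have e1 : T / p * (Real.log (T + p) - Real.log p - (Real.log T - Real.log p)) * p
        = T * (Real.log (T + p) - Real.log T) := by
      field_simp
      ring
    have e2 : ((T + p) / p * (Real.log (T + p) - Real.log p)
        - T / p * (Real.log T - Real.log p)) * p
        = (T + p) * Real.log (T + p) - T * Real.log T - p * Real.log p := by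
      field_simp
      ring
    rw [e1, add_mul, mul_assoc (tangentSlope E₀), e2] at this
    exact this

/-- From `ln u ≤ u - 1` at `u = a / (b y)`. For fixed `y` the right side is linear in `(a, b)`, so
it can be summed; taking for `y` the ratio of the sums gives the log-sum inequality. -/
theorem log_sum_step {a b y : ℝ} (ha : 0 < a) (hb : 0 < b) (hy : 0 < y) :
    b * (Real.log a - Real.log b) ≤ b * (Real.log y - 1) + a / y := by
  have h := Real.log_le_sub_one_of_pos (show 0 < a / (b * y) by positivity)
  rw [Real.log_div ha.ne' (by positivity), Real.log_mul hb.ne' hy.ne'] at h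
  have h2 := mul_le_mul_of_nonneg_left h hb.le
  have h3 : b * (a / (b * y) - 1) = a / y - b := by field_simp
  rw [h3] at h2
  linarith

/-- The tail sums of a finite sequence. -/
def tailSum (p : ℕ → ℝ) (m k : ℕ) : ℝ := ∑ n ∈ Finset.Ico k (m + 1), p n

theorem tailSum_eq_add {p : ℕ → ℝ} {m k : ℕ} (hk : k ≤ m) :
    tailSum p m k = tailSum p m (k + 1) + p k := by
  rw [tailSum, tailSum, Finset.sum_eq_sum_Ico_succ_bot (by omega), add_comm]

theorem tailSum_nonneg {p : ℕ → ℝ} {m : ℕ} (hp : ∀ n ≤ m, 0 < p n) (k : ℕ) :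
    0 ≤ tailSum p m k :=
  Finset.sum_nonneg fun n hn => (hp n (by simp at hn; omega)).le

theorem tailSum_pos {p : ℕ → ℝ} {m k : ℕ} (hp : ∀ n ≤ m, 0 < p n) (hk : k ≤ m) :
    0 < tailSum p m k := by
  rw [tailSum_eq_add hk]
  exact add_pos_of_nonneg_of_pos (tailSum_nonneg hp _) (hp k hk)

theorem sum_mul_log_le_tailSum {p : ℕ → ℝ} {m k : ℕ} (hp : ∀ n ≤ m, 0 < p n) (hk : k < m) :
    ∑ n ∈ Finset.Ico k m, p (n + 1) * (Real.log (p n) - Real.log (p (n + 1))) ≤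
      tailSum p m (k + 1) * (Real.log (tailSum p m k) - Real.log (tailSum p m (k + 1))) := by
  have h0 := tailSum_pos hp hk.le
  have h1 := tailSum_pos hp (show k + 1 ≤ m from hk)
  set y := tailSum p m k / tailSum p m (k + 1) with hy
  have hy0 : 0 < y := div_pos h0 h1
  have hlog : Real.log y = Real.log (tailSum p m k) - Real.log (tailSum p m (k + 1)) :=
    Real.log_div h0.ne' h1.ne'
  have e1 : ∑ n ∈ Finset.Ico k m, p (n + 1) = tailSum p m (k + 1) := by
    rw [tailSum, ← Finset.sum_Ico_add' p k m 1]
  -- The shifted sum is exactly the tail at `k + 1`, whereas this one lacks `p m`; the loss is in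
  -- the favourable direction.
  have e2 : ∑ n ∈ Finset.Ico k m, p n ≤ tailSum p m k := by
    rw [tailSum, Finset.sum_Ico_succ_top hk.le]
    linarith [hp m le_rfl]
  calc _ ≤ ∑ n ∈ Finset.Ico k m, (p (n + 1) * (Real.log y - 1) + p n / y) :=
        Finset.sum_le_sum fun n hn => by
          rw [Finset.mem_Ico] at hn
          exact log_sum_step (hp n hn.2.le) (hp (n + 1) hn.2) hy0
    _ = tailSum p m (k + 1) * (Real.log y - 1) + (∑ n ∈ Finset.Ico k m, p n) / y := by
        rw [Finset.sum_add_distrib, ← Finset.sum_mul, ← Finset.sum_div, e1]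
    _ ≤ tailSum p m (k + 1) * (Real.log y - 1) + tailSum p m k / y := by gcongr
    _ = _ := by
        rw [← hlog, hy, div_div_cancel₀ h0.ne']
        ring

theorem sum_mul_log_le_tangent {p : ℕ → ℝ} {m : ℕ} (hp : ∀ n ≤ m, 0 < p n)
    (hsum : ∑ n ∈ Finset.range (m + 1), p n = 1) {E₀ : ℝ} (hE₀ : 0 < E₀) :
    ∑ n ∈ Finset.range m, ((n : ℝ) + 1) * (p (n + 1) * (Real.log (p n) - Real.log (p (n + 1)))) ≤
      tangentValue E₀ + tangentSlope E₀ * ∑ n ∈ Finset.range (m + 1), Real.negMulLog (p n) := by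
  -- The weight `n + 1` counts the indices `k ≤ n`.
  have hswap : ∑ n ∈ Finset.range m,
        ((n : ℝ) + 1) * (p (n + 1) * (Real.log (p n) - Real.log (p (n + 1))))
      = ∑ k ∈ Finset.range m, ∑ n ∈ Finset.Ico k m,
        p (n + 1) * (Real.log (p n) - Real.log (p (n + 1))) := by
    rw [Finset.sum_comm' (t' := Finset.range m) (s' := fun n => Finset.range (n + 1))]
    · refine Finset.sum_congr rfl fun n _ => ?_
      simp
    · intro k n
      simp only [Finset.mem_range, Finset.mem_Ico]
      omega
  set T := tailSum p m with hT
  have hT0 : T 0 = 1 := by rw [hT, tailSum, ← hsum, Finset.range_eq_Ico]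
  have hTm : T (m + 1) = 0 := by simp [hT, tailSum]
  calc _ ≤ ∑ k ∈ Finset.range m, T (k + 1) * (Real.log (T k) - Real.log (T (k + 1))) := by
        rw [hswap]
        exact Finset.sum_le_sum fun k hk => sum_mul_log_le_tailSum hp (Finset.mem_range.1 hk)
    -- The added term `k = m` vanishes because `T (m + 1) = 0`. With it the sum of `p` is complete
    -- and the telescoping runs from `T 0 = 1` to `0`.
    _ = ∑ k ∈ Finset.range (m + 1), T (k + 1) * (Real.log (T k) - Real.log (T (k + 1))) := by
        rw [Finset.sum_range_succ, hTm, zero_mul, add_zero]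
    _ ≤ ∑ k ∈ Finset.range (m + 1), (tangentValue E₀ * p k + tangentSlope E₀ *
          (T k * Real.log (T k) - T (k + 1) * Real.log (T (k + 1)) - p k * Real.log (p k))) := by
        refine Finset.sum_le_sum fun k hk => ?_
        have hk' : k ≤ m := Nat.lt_succ_iff.1 (Finset.mem_range.1 hk)
        have := mul_log_div_le_tangent (tailSum_nonneg hp (k + 1)) (hp k hk') hE₀
        rwa [← tailSum_eq_add hk'] at this
    _ = _ := by
        rw [Finset.sum_add_distrib, ← Finset.mul_sum, ← Finset.mul_sum, hsum,
          Finset.sum_sub_distrib, Finset.sum_range_sub' (fun k => T k * Real.log (T k)), hT0, hTm]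
        simp [Real.negMulLog, Finset.sum_neg_distrib]

theorem f_zero : f 0 = 0 := by
  have h0 : g 0 = 0 := by simp [g]
  have h1 : gInv 0 = 0 := by
    have := bijOn_g.injOn.leftInvOn_invFunOn (Set.self_mem_Ici (a := (0 : ℝ)))
    rwa [h0] at this
  simp [f, h1]

theorem neg_f_eq_tangent {S : ℝ} (hS : 0 < S) :
    0 < gInv S ∧ -f S = tangentValue (gInv S) + tangentSlope (gInv S) * S := by
  have h0 : g 0 = 0 := by simp [g]
  have h1 : g (gInv S) = S := bijOn_g.surjOn.rightInvOn_invFunOn hS.le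
  have h2 : 0 ≤ gInv S := bijOn_g.surjOn.mapsTo_invFunOn hS.le
  have h3 : 0 < gInv S := by
    refine h2.lt_of_ne fun h => ?_
    rw [← h, h0] at h1
    exact hS.ne h1
  refine ⟨h3, ?_⟩
  rw [f, (hasDerivAt_g h3).deriv, tangentValue, h1]
  ring

theorem sum_mul_log_le_neg_f {p : ℕ → ℝ} {m : ℕ} (hp : ∀ n ≤ m, 0 < p n)
    (hsum : ∑ n ∈ Finset.range (m + 1), p n = 1) :
    ∑ n ∈ Finset.range m, ((n : ℝ) + 1) * (p (n + 1) * (Real.log (p n) - Real.log (p (n + 1)))) ≤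
      -f (∑ n ∈ Finset.range (m + 1), Real.negMulLog (p n)) := by
  have hS : 0 ≤ ∑ n ∈ Finset.range (m + 1), Real.negMulLog (p n) := by
    refine Finset.sum_nonneg fun n hn => ?_
    have hn' := hp n (Nat.lt_succ_iff.1 (Finset.mem_range.1 hn))
    refine Real.negMulLog_nonneg hn'.le ?_
    rw [← hsum]
    exact Finset.single_le_sum (fun i hi => (hp i (Nat.lt_succ_iff.1 (Finset.mem_range.1 hi))).le) hn
  rcases hS.eq_or_lt with h | h
  · rw [← h, f_zero, neg_zero]
    -- Tangents at points `ε → 0` replace the missing tangent at `0`.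
    refine le_of_forall_pos_le_add fun ε hε => ?_
    have h1 := sum_mul_log_le_tangent hp hsum hε
    rw [← h, mul_zero, add_zero] at h1
    linarith [tangentValue_le hε]
  · obtain ⟨h1, h2⟩ := neg_f_eq_tangent h
    rw [h2]
    exact sum_mul_log_le_tangent hp hsum h1

/-! ### Comparison with the passive rearrangement -/

theorem sum_range_antisymm (B : ℕ → ℕ → ℝ) (k : ℕ) :
    ∑ j ∈ Finset.range k, ∑ i ∈ Finset.range k, (B i j - B j i) = 0 := by
  simp only [Finset.sum_sub_distrib]
  rw [Finset.sum_comm, sub_self]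

theorem sum_range_antisymm_split (B : ℕ → ℕ → ℝ) {k n : ℕ} (hk : k ≤ n) :
    ∑ j ∈ Finset.range k, ∑ i ∈ Finset.range n, (B i j - B j i) =
      ∑ j ∈ Finset.range k, ∑ i ∈ Finset.Ico k n, (B i j - B j i) := by
  have : ∀ j, ∑ i ∈ Finset.range n, (B i j - B j i) = ∑ i ∈ Finset.range k, (B i j - B j i) +
      ∑ i ∈ Finset.Ico k n, (B i j - B j i) := fun j =>
    (Finset.sum_range_add_sum_Ico _ hk).symm
  simp only [this]
  rw [Finset.sum_add_distrib, sum_range_antisymm, zero_add]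

/-- Think of `A i j` as the rate from `i` to `j`. Transfers inside the first `k` levels cancel.
Across the cut `p i ≤ p k ≤ p j`, so both weights may be replaced by `p k`; the same cancellation
read backwards then restores full sums of `A`, and `hAA` contributes at most one per level. -/
theorem partialSum_flow_le {p : ℕ → ℝ} {A : ℕ → ℕ → ℝ} {m k : ℕ} (hk : k ≤ m)
    (hp : ∀ n ≤ m, 0 < p n) (hanti : ∀ i j, i ≤ j → j ≤ m → p j ≤ p i)
    (hA : ∀ i j, 0 ≤ A i j)
    (hAA : ∀ j ≤ m, ∑ i ∈ Finset.range (m + 1), A i j ≤ ∑ i ∈ Finset.range (m + 1), A j i + 1) :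
    ∑ j ∈ Finset.range k, ∑ i ∈ Finset.range (m + 1), (p i * A i j - p j * A j i) ≤ k * p k := by
  rw [sum_range_antisymm_split (fun i j => p i * A i j) (by omega)]
  calc _ ≤ ∑ j ∈ Finset.range k, ∑ i ∈ Finset.Ico k (m + 1), p k * (A i j - A j i) := by
        refine Finset.sum_le_sum fun j hj => Finset.sum_le_sum fun i hi => ?_
        rw [Finset.mem_range] at hj
        rw [Finset.mem_Ico] at hi
        have h1 := mul_le_mul_of_nonneg_right (hanti k i hi.1 (by omega)) (hA i j)
        have h2 := mul_le_mul_of_nonneg_right (hanti j k hj.le hk) (hA j i)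
        linarith
    _ = p k * ∑ j ∈ Finset.range k, ∑ i ∈ Finset.range (m + 1), (A i j - A j i) := by
        rw [sum_range_antisymm_split A (by omega), Finset.mul_sum]
        simp only [Finset.mul_sum]
    _ ≤ p k * ∑ j ∈ Finset.range k, 1 := by
        refine mul_le_mul_of_nonneg_left (Finset.sum_le_sum fun j hj => ?_) (hp k hk).le
        have := hAA j (by rw [Finset.mem_range] at hj; omega)
        rw [Finset.sum_sub_distrib]
        linarith
    _ = k * p k := by simp [mul_comm]

theorem f_le_flow_of_pos {p : ℕ → ℝ} {A : ℕ → ℕ → ℝ} {m : ℕ}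
    (hp : ∀ n ≤ m, 0 < p n) (hanti : ∀ i j, i ≤ j → j ≤ m → p j ≤ p i)
    (hsum : ∑ n ∈ Finset.range (m + 1), p n = 1) (hA : ∀ i j, 0 ≤ A i j)
    (hAA : ∀ j ≤ m, ∑ i ∈ Finset.range (m + 1), A i j ≤ ∑ i ∈ Finset.range (m + 1), A j i + 1) :
    f (∑ n ∈ Finset.range (m + 1), Real.negMulLog (p n)) ≤
      ∑ i ∈ Finset.range (m + 1), ∑ j ∈ Finset.range (m + 1),
        p i * A i j * (Real.log (p i) - Real.log (p j)) := by
  set l : ℕ → ℝ := fun j => ∑ i ∈ Finset.range (m + 1), (p i * A i j - p j * A j i) with hl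
  have h1 : ∑ i ∈ Finset.range (m + 1), ∑ j ∈ Finset.range (m + 1),
        p i * A i j * (Real.log (p i) - Real.log (p j))
      = - ∑ j ∈ Finset.range (m + 1), Real.log (p j) * l j := by
    simp only [hl, mul_sub, Finset.sum_sub_distrib, Finset.mul_sum]
    rw [neg_sub]
    congr 1
    · exact Finset.sum_congr rfl fun i _ => Finset.sum_congr rfl fun j _ => by ring
    · rw [Finset.sum_comm]
      exact Finset.sum_congr rfl fun i _ => Finset.sum_congr rfl fun j _ => by ring
  have h2 : ∑ j ∈ Finset.range (m + 1), Real.log (p j) * l j ≤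
      ∑ n ∈ Finset.range m,
        ((n : ℝ) + 1) * (p (n + 1) * (Real.log (p n) - Real.log (p (n + 1)))) := by
    -- Abel summation; the boundary term carries the total flow, which is zero by antisymmetry.
    have := Finset.sum_range_by_parts (fun j => Real.log (p j)) l (m + 1)
    simp only [smul_eq_mul, Nat.add_sub_cancel] at this
    rw [this, show ∑ j ∈ Finset.range (m + 1), l j = 0 from
      sum_range_antisymm (fun i j => p i * A i j) (m + 1), mul_zero, zero_sub,
      ← Finset.sum_neg_distrib]
    refine Finset.sum_le_sum fun n hn => ?_
    rw [Finset.mem_range] at hn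
    have h3 := partialSum_flow_le (k := n + 1) hn hp hanti hA hAA
    have h4 : 0 ≤ Real.log (p n) - Real.log (p (n + 1)) :=
      sub_nonneg.2 (Real.log_le_log (hp _ hn) (hanti n (n + 1) (by omega) hn))
    have := mul_le_mul_of_nonneg_left h3 h4
    push_cast at this
    simp only [hl]
    linarith
  have h3 := sum_mul_log_le_neg_f hp hsum
  rw [h1]
  linarith

/-- The sequence is cut at the largest index `m` with positive weight. By `hleak` no rate leads out
of the support, so for `j ≤ m` the outgoing sums `∑ i, A j i` are unchanged, while the incoming ones
can only decrease; thus `hAA` survives the cut. -/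
theorem f_le_flow {d : ℕ} {p : Fin d → ℝ} {A : Fin d → Fin d → ℝ} (hp : ∀ i, 0 ≤ p i)
    (hanti : Antitone p) (hsum : ∑ i, p i = 1) (hA : ∀ i j, 0 ≤ A i j)
    (hAA : ∀ j, ∑ i, A i j ≤ ∑ i, A j i + 1)
    (hleak : ∀ i j, p j = 0 → p i * A i j = 0) :
    f (∑ i, Real.negMulLog (p i)) ≤
      ∑ i, ∑ j, p i * A i j * (Real.log (p i) - Real.log (p j)) := by
  set q : ℕ → ℝ := fun n => if h : n < d then p ⟨n, h⟩ else 0 with hq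
  set B : ℕ → ℕ → ℝ := fun n k => if h : n < d ∧ k < d then A ⟨n, h.1⟩ ⟨k, h.2⟩ else 0 with hB
  have hqp : ∀ i : Fin d, p i = q i := fun i => by simp [hq]
  have hBA : ∀ i j : Fin d, A i j = B i j := fun i j => by simp [hB]
  have hB0 : ∀ i j, 0 ≤ B i j := fun i j => by
    simp only [hB]
    split_ifs
    · exact hA _ _
    · exact le_rfl
  simp only [hqp, hBA] at hp hsum hA hAA hleak ⊢
  have sum_eq : ∀ F : ℕ → ℝ, ∑ i : Fin d, F i = ∑ n ∈ Finset.range d, F n :=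
    fun F => Fin.sum_univ_eq_sum_range F d
  have hAA' : ∀ j < d, ∑ i ∈ Finset.range d, B i j ≤ ∑ i ∈ Finset.range d, B j i + 1 := by
    intro j hj
    have := hAA ⟨j, hj⟩
    rwa [sum_eq (fun i => B i j), sum_eq (fun i => B j i)] at this
  have hleak' : ∀ i < d, ∀ j < d, q j = 0 → q i * B i j = 0 := fun i hi j hj h =>
    hleak ⟨i, hi⟩ ⟨j, hj⟩ h
  have hanti' : ∀ i j, i ≤ j → j < d → q j ≤ q i := fun i j hij hj => by
    have hi : i < d := by omega
    have := hanti (show (⟨i, hi⟩ : Fin d) ≤ ⟨j, hj⟩ from hij)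
    simpa [hq, hi, hj] using this
  have hp' : ∀ i < d, 0 ≤ q i := fun i hi => hp ⟨i, hi⟩
  have e1 : ∑ i : Fin d, ∑ j : Fin d, q i * B i j * (Real.log (q i) - Real.log (q j)) =
      ∑ i ∈ Finset.range d, ∑ j ∈ Finset.range d,
        q i * B i j * (Real.log (q i) - Real.log (q j)) := by
    rw [← sum_eq (fun i => ∑ j ∈ Finset.range d, q i * B i j * (Real.log (q i) - Real.log (q j)))]
    exact Finset.sum_congr rfl fun i _ =>
      sum_eq (fun j => q i * B i j * (Real.log (q i) - Real.log (q j)))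
  rw [e1, sum_eq (fun i => Real.negMulLog (q i))]
  rw [sum_eq q] at hsum
  have hne : ((Finset.range d).filter fun n => 0 < q n).Nonempty := by
    obtain ⟨n, hn, hn'⟩ := Finset.exists_ne_zero_of_sum_ne_zero (hsum ▸ one_ne_zero)
    exact ⟨n, Finset.mem_filter.2 ⟨hn, (hp' n (Finset.mem_range.1 hn)).lt_of_ne' hn'⟩⟩
  obtain ⟨m, hm, hmax⟩ := Finset.exists_max_image _ id hne
  simp only [Finset.mem_filter, Finset.mem_range, id, and_imp] at hm hmax
  have hpos : ∀ n ≤ m, 0 < q n := fun n hn => hm.2.trans_le (hanti' n m hn hm.1)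
  have hzero : ∀ n < d, n ∉ Finset.range (m + 1) → q n = 0 := fun n hn hnm => by
    by_contra h
    have := hmax n hn ((hp' n hn).lt_of_ne' h)
    simp at hnm
    omega
  have hsub : Finset.range (m + 1) ⊆ Finset.range d := Finset.range_subset_range.2 hm.1
  have hBz : ∀ i ≤ m, ∀ j < d, j ∉ Finset.range (m + 1) → B i j = 0 := fun i hi j hj hjm =>
    (mul_eq_zero.1 (hleak' i (by omega) j hj (hzero j hj hjm))).resolve_left (hpos i hi).ne'
  have restrict : ∀ F : ℕ → ℝ, (∀ n < d, n ∉ Finset.range (m + 1) → F n = 0) →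
      ∑ n ∈ Finset.range d, F n = ∑ n ∈ Finset.range (m + 1), F n := fun F hF =>
    (Finset.sum_subset hsub fun n hn hnm => hF n (Finset.mem_range.1 hn) hnm).symm
  have e2 : ∑ i ∈ Finset.range d, ∑ j ∈ Finset.range d,
        q i * B i j * (Real.log (q i) - Real.log (q j)) =
      ∑ i ∈ Finset.range (m + 1), ∑ j ∈ Finset.range (m + 1),
        q i * B i j * (Real.log (q i) - Real.log (q j)) := by
    rw [restrict _ fun n hn hnm => by simp [hzero n hn hnm]]
    refine Finset.sum_congr rfl fun i hi => restrict _ fun n hn hnm => ?_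
    rw [hBz i (Nat.lt_succ_iff.1 (Finset.mem_range.1 hi)) n hn hnm, mul_zero, zero_mul]
  rw [e2, restrict _ fun n hn hnm => by rw [hzero n hn hnm, Real.negMulLog_zero]]
  rw [restrict _ hzero] at hsum
  refine f_le_flow_of_pos hpos (fun i j hij hj => hanti' i j hij (by omega)) hsum hB0 fun j hj => ?_
  have h1 := hAA' j (by omega)
  rw [restrict (fun i => B j i) (hBz j hj)] at h1
  exact (Finset.sum_le_sum_of_subset_of_nonneg hsub fun i _ _ => hB0 i j).trans h1

/-! ### Functional calculus and trace in finite dimension -/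

section FiniteDim

variable {H : Type*} [NormedAddCommGroup H] [InnerProductSpace ℂ H] [FiniteDimensional ℂ H]
  [CompleteSpace H] {ι : Type*} [Fintype ι]

theorem finite_spectrum_real (A : H →L[ℂ] H) : (spectrum ℝ A).Finite := by
  have h1 : spectrum ℂ A = spectrum ℂ ((Module.End.toContinuousLinearMap H).symm A) :=
    (AlgEquiv.spectrum_eq _ A).symm
  have h2 : (spectrum ℂ A).Finite := h1 ▸ Module.End.finite_spectrum _
  rw [← spectrum.preimage_algebraMap ℂ]
  exact h2.preimage (FaithfulSMul.algebraMap_injective ℝ ℂ).injOn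

theorem continuousOn_spectrum_real (φ : ℝ → ℝ) (A : H →L[ℂ] H) :
    ContinuousOn φ (spectrum ℝ A) :=
  (finite_spectrum_real A).continuousOn φ

/-- The spectrum is finite, so every function is continuous on it. Writing `φ y = φ x + h y * (y -
x)` gives `φ(A) = φ x + h(A) (A - x)`, and `A - x` kills `v`. -/
theorem cfc_apply_of_eigenvector {A : H →L[ℂ] H} (hA : IsSelfAdjoint A) (φ : ℝ → ℝ) {x : ℝ} {v : H}
    (hv : A v = (x : ℂ) • v) : cfc φ A v = (φ x : ℂ) • v := by
  have h1 : (fun y => φ y) = fun y => φ x + (φ y - φ x) / (y - x) * (y - x) := by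
    funext y
    rcases eq_or_ne y x with rfl | h
    · simp
    · rw [div_mul_cancel₀ _ (sub_ne_zero.2 h)]
      ring
  have h2 : cfc φ A = algebraMap ℝ (H →L[ℂ] H) (φ x) +
      cfc (fun y => (φ y - φ x) / (y - x)) A * (A - algebraMap ℝ (H →L[ℂ] H) x) := by
    conv_lhs => rw [show φ = fun y => φ x + (φ y - φ x) / (y - x) * (y - x) from h1]
    rw [cfc_const_add _ _ _ (continuousOn_spectrum_real _ A) hA,
      cfc_mul _ _ _ (continuousOn_spectrum_real _ A) (continuousOn_spectrum_real _ A),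
      cfc_sub _ _ _ (continuousOn_spectrum_real _ A) (continuousOn_spectrum_real _ A),
      cfc_const _ _ hA, cfc_id' ℝ A hA]
  have h3 : ∀ c : ℝ, algebraMap ℝ (H →L[ℂ] H) c v = (c : ℂ) • v := by
    intro c
    rw [Algebra.algebraMap_eq_smul_one]
    simp
  rw [h2]
  simp [h3, hv]

/-- The real part of the trace. -/
def reTrace (A : H →L[ℂ] H) : ℝ := (LinearMap.trace ℂ H (A : H →ₗ[ℂ] H)).re

theorem reTrace_eq_sum (b : OrthonormalBasis ι ℂ H) (A : H →L[ℂ] H) :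
    reTrace A = ∑ i, (⟪b i, A (b i)⟫_ℂ).re := by
  rw [reTrace, LinearMap.trace_eq_sum_inner _ b, Complex.re_sum]
  rfl

theorem reTrace_add (A B : H →L[ℂ] H) : reTrace (A + B) = reTrace A + reTrace B := by
  simp [reTrace]

theorem reTrace_sub (A B : H →L[ℂ] H) : reTrace (A - B) = reTrace A - reTrace B := by
  simp [reTrace]

theorem reTrace_smul (c : ℝ) (A : H →L[ℂ] H) : reTrace (c • A) = c * reTrace A := by
  rw [reTrace_eq_sum (stdOrthonormalBasis ℂ H), reTrace_eq_sum (stdOrthonormalBasis ℂ H),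
    Finset.mul_sum]
  refine Finset.sum_congr rfl fun i _ => ?_
  rw [smul_apply, inner_smul_right_eq_smul]
  simp

theorem reTrace_mul_comm (A B : H →L[ℂ] H) : reTrace (A * B) = reTrace (B * A) :=
  congrArg Complex.re (LinearMap.trace_mul_comm ℂ (A : H →ₗ[ℂ] H) (B : H →ₗ[ℂ] H))

theorem continuous_reTrace : Continuous (reTrace : (H →L[ℂ] H) → ℝ) := by
  have : (reTrace : (H →L[ℂ] H) → ℝ) = fun A => ∑ i, (⟪stdOrthonormalBasis ℂ H i,
      A (stdOrthonormalBasis ℂ H i)⟫_ℂ).re := funext (reTrace_eq_sum _)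
  rw [this]
  fun_prop

theorem re_inner_apply_of_eigenbasis {A : H →L[ℂ] H} {b : OrthonormalBasis ι ℂ H} {p : ι → ℝ}
    (hb : ∀ i, A (b i) = (p i : ℂ) • b i) (v : H) :
    (⟪v, A v⟫_ℂ).re = ∑ i, p i * ‖⟪b i, v⟫_ℂ‖ ^ 2 := by
  have h : A v = ∑ i, ⟪b i, v⟫_ℂ • (p i : ℂ) • b i := by
    conv_lhs => rw [← b.sum_repr' v]
    simp [map_sum, hb]
  rw [h, inner_sum, Complex.re_sum]
  refine Finset.sum_congr rfl fun i _ => ?_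
  rw [inner_smul_right, inner_smul_right, mul_left_comm, ← inner_conj_symm v (b i),
    Complex.mul_conj, Complex.normSq_eq_norm_sq, ← Complex.ofReal_mul, Complex.ofReal_re]

theorem reTrace_mul_of_eigenbasis {A : H →L[ℂ] H} {b : OrthonormalBasis ι ℂ H} {p : ι → ℝ}
    (hb : ∀ i, A (b i) = (p i : ℂ) • b i) (B : H →L[ℂ] H) :
    reTrace (B * A) = ∑ i, p i * (⟪b i, B (b i)⟫_ℂ).re := by
  rw [reTrace_eq_sum b]
  refine Finset.sum_congr rfl fun i _ => ?_
  simp [hb]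

theorem reTrace_of_eigenbasis {A : H →L[ℂ] H} {b : OrthonormalBasis ι ℂ H} {p : ι → ℝ}
    (hb : ∀ i, A (b i) = (p i : ℂ) • b i) : reTrace A = ∑ i, p i := by
  rw [reTrace_eq_sum b]
  refine Finset.sum_congr rfl fun i _ => ?_
  simp [hb]

theorem eigenvalue_nonneg {A : H →L[ℂ] H} (hA : A.IsPositive) {b : OrthonormalBasis ι ℂ H}
    {p : ι → ℝ} (hb : ∀ i, A (b i) = (p i : ℂ) • b i) (i : ι) : 0 ≤ p i := by
  have h := hA.re_inner_nonneg_right (b i)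
  rw [hb, inner_smul_right, inner_self_eq_norm_sq_to_K] at h
  simpa using h

theorem exists_eigenbasis {A : H →L[ℂ] H} (hA : IsSelfAdjoint A) :
    ∃ (b : OrthonormalBasis (Fin (Module.finrank ℂ H)) ℂ H) (p : Fin (Module.finrank ℂ H) → ℝ),
      Antitone p ∧ ∀ i, A (b i) = (p i : ℂ) • b i :=
  have hs : (A : H →ₗ[ℂ] H).IsSymmetric := hA.isSymmetric
  ⟨hs.eigenvectorBasis rfl, hs.eigenvalues rfl, hs.eigenvalues_antitone rfl,
    hs.apply_eigenvectorBasis rfl⟩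

theorem cfc_apply_eigenbasis {A : H →L[ℂ] H} (hA : IsSelfAdjoint A) {b : OrthonormalBasis ι ℂ H}
    {p : ι → ℝ} (hb : ∀ i, A (b i) = (p i : ℂ) • b i) (φ : ℝ → ℝ) (i : ι) :
    cfc φ A (b i) = ((φ (p i) : ℝ) : ℂ) • b i :=
  cfc_apply_of_eigenvector hA φ (hb i)

/-! ### Klein's inequality with a regularised logarithm. -/

theorem negMulLog_le_cross {x y : ℝ} (hx : 0 ≤ x) (hy : 0 < y) :
    Real.negMulLog x ≤ x * -Real.log y + y - x := by
  rcases hx.eq_or_lt with rfl | hx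
  · simp [hy.le]
  · have h := Real.log_le_sub_one_of_pos (show 0 < y / x by positivity)
    rw [Real.log_div hy.ne' hx.ne'] at h
    have h2 := mul_le_mul_of_nonneg_left h hx.le
    have h3 : x * (y / x - 1) = y - x := by field_simp
    rw [Real.negMulLog]
    linarith

/-- The operator `-ln (A + δ)`. -/
def negLogAdd (δ : ℝ) (A : H →L[ℂ] H) : H →L[ℂ] H := cfc (fun x : ℝ => -Real.log (x + δ)) A

theorem isSelfAdjoint_negLogAdd (δ : ℝ) (A : H →L[ℂ] H) : IsSelfAdjoint (negLogAdd δ A) :=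
  cfc_predicate _ A

/-- Klein's inequality. -/
theorem reTrace_negMulLog_le {A B : H →L[ℂ] H} (hA : A.IsPositive) (hB : B.IsPositive) {δ : ℝ}
    (hδ : 0 < δ) :
    reTrace (cfc Real.negMulLog A) ≤
      reTrace (A * negLogAdd δ B) + (reTrace B + δ * Module.finrank ℂ H) - reTrace A := by
  obtain ⟨b, p, -, hb⟩ := exists_eigenbasis hA.isSelfAdjoint
  obtain ⟨c, q, -, hc⟩ := exists_eigenbasis hB.isSelfAdjoint
  have hp := eigenvalue_nonneg hA hb
  have hq := eigenvalue_nonneg hB hc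
  -- The squared overlaps of the two eigenbases are doubly stochastic weights. All the traces become
  -- sums with these weights, and the claim reduces to the scalar inequality for each pair of
  -- eigenvalues.
  have hw1 : ∀ i, ∑ j, ‖⟪b i, c j⟫_ℂ‖ ^ 2 = 1 := fun i => by
    rw [c.sum_sq_norm_inner_left (b i)]
    simp
  have hw2 : ∀ j, ∑ i, ‖⟪b i, c j⟫_ℂ‖ ^ 2 = 1 := fun j => by
    rw [b.sum_sq_norm_inner_right (c j)]
    simp
  have e1 : reTrace (cfc Real.negMulLog A)
      = ∑ i, ∑ j, ‖⟪b i, c j⟫_ℂ‖ ^ 2 * Real.negMulLog (p i) := by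
    rw [reTrace_of_eigenbasis (cfc_apply_eigenbasis hA.isSelfAdjoint hb _)]
    simp only [← Finset.sum_mul, hw1, one_mul]
  have e2 : reTrace A = ∑ i, ∑ j, ‖⟪b i, c j⟫_ℂ‖ ^ 2 * p i := by
    rw [reTrace_of_eigenbasis hb]
    simp only [← Finset.sum_mul, hw1, one_mul]
  have e3 : reTrace B + δ * Module.finrank ℂ H
      = ∑ i, ∑ j, ‖⟪b i, c j⟫_ℂ‖ ^ 2 * (q j + δ) := by
    rw [Finset.sum_comm, reTrace_of_eigenbasis hc]
    simp only [← Finset.sum_mul, hw2, one_mul, Finset.sum_add_distrib]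
    simp [mul_comm]
  have e4 : reTrace (A * negLogAdd δ B)
      = ∑ i, ∑ j, ‖⟪b i, c j⟫_ℂ‖ ^ 2 * (p i * -Real.log (q j + δ)) := by
    rw [negLogAdd, reTrace_mul_of_eigenbasis (cfc_apply_eigenbasis hB.isSelfAdjoint hc _),
      Finset.sum_comm]
    refine Finset.sum_congr rfl fun j _ => ?_
    rw [re_inner_apply_of_eigenbasis hb, Finset.mul_sum]
    exact Finset.sum_congr rfl fun i _ => by ring
  rw [e1, e2, e3, e4, ← Finset.sum_add_distrib, ← Finset.sum_sub_distrib]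
  refine Finset.sum_le_sum fun i _ => ?_
  rw [← Finset.sum_add_distrib, ← Finset.sum_sub_distrib]
  refine Finset.sum_le_sum fun j _ => ?_
  have := mul_le_mul_of_nonneg_left (negMulLog_le_cross (hp i) (add_pos_of_nonneg_of_pos (hq j) hδ))
    (sq_nonneg ‖⟪b i, c j⟫_ℂ‖)
  linarith

theorem mul_neg_log_add_le {x δ : ℝ} (hx : 0 ≤ x) (hδ : 0 < δ) :
    x * -Real.log (x + δ) ≤ Real.negMulLog x ∧
      Real.negMulLog x ≤ x * -Real.log (x + δ) + δ := by
  refine ⟨?_, by linarith [negMulLog_le_cross hx (show 0 < x + δ by positivity)]⟩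
  rcases hx.eq_or_lt with rfl | hx
  · simp
  · have := Real.log_le_log hx (show x ≤ x + δ by linarith)
    rw [Real.negMulLog]
    nlinarith

theorem reTrace_mul_negLogAdd_le {A : H →L[ℂ] H} (hA : A.IsPositive) {δ : ℝ} (hδ : 0 < δ) :
    reTrace (A * negLogAdd δ A) ≤ reTrace (cfc Real.negMulLog A) := by
  obtain ⟨b, p, -, hb⟩ := exists_eigenbasis hA.isSelfAdjoint
  have hp := eigenvalue_nonneg hA hb
  rw [negLogAdd, reTrace_mul_of_eigenbasis (cfc_apply_eigenbasis hA.isSelfAdjoint hb _),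
    reTrace_of_eigenbasis (cfc_apply_eigenbasis hA.isSelfAdjoint hb _)]
  refine Finset.sum_le_sum fun i _ => ?_
  rw [hb, inner_smul_right, inner_self_eq_norm_sq_to_K]
  have := (mul_neg_log_add_le (hp i) hδ).1
  simp
  linarith

end FiniteDim

/-! ### The derivative of the entropy along a Lindblad evolution -/

section FiniteDim

variable {H : Type*} [NormedAddCommGroup H] [InnerProductSpace ℂ H] [FiniteDimensional ℂ H]
  [CompleteSpace H] {ι : Type*} [Fintype ι]

theorem spectrum_subset_Icc {Q : H →L[ℂ] H} (hQ : Q.IsPositive) {c : ℝ} (hc : ‖Q‖ ≤ c) :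
    spectrum ℝ Q ⊆ Set.Icc 0 c := by
  intro x hx
  refine ⟨spectrum_nonneg_of_nonneg ((ContinuousLinearMap.nonneg_iff_isPositive Q).2 hQ) hx, ?_⟩
  have h1 := spectrum.norm_le_norm_mul_of_mem hx
  have h2 : ‖(1 : H →L[ℂ] H)‖ ≤ 1 := ContinuousLinearMap.norm_id_le
  calc x ≤ ‖x‖ := le_abs_self x
    _ ≤ ‖Q‖ * ‖(1 : H →L[ℂ] H)‖ := h1
    _ ≤ ‖Q‖ * 1 := by gcongr
    _ ≤ c := by linarith

/-- This is the reason for `δ = t²`: the norm grows only like `|ln t|`, so it is harmless against an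
`O(t)` factor, while the error `δ * dim H` in Klein's inequality is still `o(t)`. -/
theorem norm_negLogAdd_le {Q : H →L[ℂ] H} (hQ : Q.IsPositive) {c t : ℝ} (hc : ‖Q‖ ≤ c)
    (ht : 0 < t) (ht1 : t ≤ 1) :
    ‖negLogAdd (t ^ 2) Q‖ ≤ Real.log (c + 1) - 2 * Real.log t := by
  have hc0 : 0 ≤ c := (norm_nonneg _).trans hc
  have h1 : 0 ≤ Real.log (c + 1) := Real.log_nonneg (by linarith)
  have h2 : Real.log t ≤ 0 := Real.log_nonpos ht.le ht1
  refine norm_cfc_le (by linarith) fun x hx => ?_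
  obtain ⟨hx0, hxc⟩ := spectrum_subset_Icc hQ hc hx
  have h3 : Real.log (x + t ^ 2) ≤ Real.log (c + 1) :=
    Real.log_le_log (by positivity) (by nlinarith)
  have h4 : 2 * Real.log t ≤ Real.log (x + t ^ 2) := by
    have := Real.log_le_log (show 0 < t ^ 2 by positivity) (show t ^ 2 ≤ x + t ^ 2 by linarith)
    rwa [Real.log_pow, Nat.cast_ofNat] at this
  rw [norm_neg, Real.norm_eq_abs, abs_le]
  constructor <;> linarith

theorem norm_mul_negLogAdd_sub_le {Q : H →L[ℂ] H} (hQ : Q.IsPositive) {δ : ℝ} (hδ : 0 < δ) :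
    ‖Q * negLogAdd δ Q - cfc Real.negMulLog Q‖ ≤ δ := by
  have hs := hQ.isSelfAdjoint
  have : Q * negLogAdd δ Q - cfc Real.negMulLog Q
      = cfc (fun x => x * -Real.log (x + δ) - Real.negMulLog x) Q := by
    rw [cfc_sub _ _ _ (continuousOn_spectrum_real _ Q) (continuousOn_spectrum_real _ Q),
      cfc_mul _ _ _ (continuousOn_spectrum_real _ Q) (continuousOn_spectrum_real _ Q),
      cfc_id' ℝ Q hs, negLogAdd]
  rw [this]
  refine norm_cfc_le hδ.le fun x hx => ?_
  obtain ⟨h1, h2⟩ := mul_neg_log_add_le (spectrum_subset_Icc hQ le_rfl hx).1 hδ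
  rw [Real.norm_eq_abs, abs_le]
  constructor <;> linarith

theorem tendsto_of_isBigO_id {Q : ℝ → H →L[ℂ] H} {ρ : H →L[ℂ] H}
    (hO : (fun t => Q t - ρ) =O[𝓝[>] 0] fun t => t) : Tendsto Q (𝓝[>] 0) (𝓝 ρ) := by
  have h := hO.trans_tendsto (tendsto_nhdsWithin_of_tendsto_nhds tendsto_id)
  simpa using h.add_const ρ

theorem eventually_norm_negLogAdd_le {Q : ℝ → H →L[ℂ] H} {ρ : H →L[ℂ] H}
    (hQ : ∀ᶠ t in 𝓝[>] 0, (Q t).IsPositive) (hO : (fun t => Q t - ρ) =O[𝓝[>] 0] fun t => t) :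
    ∀ᶠ t in 𝓝[>] (0 : ℝ), ‖negLogAdd (t ^ 2) (Q t)‖ ≤ Real.log (‖ρ‖ + 1 + 1) - 2 * Real.log t := by
  have h1 : ∀ᶠ t in 𝓝[>] 0, ‖Q t‖ ≤ ‖ρ‖ + 1 :=
    ((tendsto_of_isBigO_id hO).norm.eventually_lt_const (lt_add_one _)).mono fun t ht => ht.le
  have h2 : ∀ᶠ t in 𝓝[>] (0 : ℝ), t ∈ Set.Ioc (0 : ℝ) 1 := Ioc_mem_nhdsGT one_pos
  filter_upwards [hQ, h1, h2] with t ht1 ht2 ht3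
  exact norm_negLogAdd_le ht1 ht2 ht3.1 ht3.2

theorem tendsto_mul_sub_log (c : ℝ) :
    Tendsto (fun t : ℝ => t * (c - 2 * Real.log t)) (𝓝[>] 0) (𝓝 0) := by
  have h1 : Tendsto (fun t : ℝ => t * Real.log t) (𝓝[>] 0) (𝓝 0) := by
    have := Real.continuous_mul_log.tendsto 0
    rw [zero_mul] at this
    exact tendsto_nhdsWithin_of_tendsto_nhds this
  have h2 : Tendsto (fun t : ℝ => t) (𝓝[>] 0) (𝓝 0) :=
    tendsto_nhdsWithin_of_tendsto_nhds tendsto_id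
  have := (h2.mul_const c).sub (h1.const_mul 2)
  simp only [zero_mul, mul_zero, sub_zero] at this
  exact this.congr fun t => by ring

theorem tendsto_mul_negLogAdd_of_isBigO {Q X : ℝ → H →L[ℂ] H} {ρ : H →L[ℂ] H}
    (hQ : ∀ᶠ t in 𝓝[>] 0, (Q t).IsPositive) (hO : (fun t => Q t - ρ) =O[𝓝[>] 0] fun t => t)
    (hX : X =O[𝓝[>] 0] fun t => t) :
    Tendsto (fun t => X t * negLogAdd (t ^ 2) (Q t)) (𝓝[>] 0) (𝓝 0) := by
  obtain ⟨C, hC⟩ := hX.bound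
  have h2 : ∀ᶠ t in 𝓝[>] (0 : ℝ), t ∈ Set.Ioi (0 : ℝ) := self_mem_nhdsWithin
  have h3 := (tendsto_mul_sub_log (Real.log (‖ρ‖ + 1 + 1))).const_mul C
  rw [mul_zero] at h3
  refine squeeze_zero_norm' ?_ h3
  filter_upwards [hC, h2, eventually_norm_negLogAdd_le hQ hO] with t ht1 ht2 ht3
  rw [Real.norm_of_nonneg (le_of_lt ht2)] at ht1
  calc _ ≤ ‖X t‖ * ‖negLogAdd (t ^ 2) (Q t)‖ := norm_mul_le _ _
    _ ≤ (C * t) * (Real.log (‖ρ‖ + 1 + 1) - 2 * Real.log t) :=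
        mul_le_mul ht1 ht3 (norm_nonneg _) ((norm_nonneg _).trans ht1)
    _ = _ := by ring

theorem tendsto_cfc_negMulLog {Q : ℝ → H →L[ℂ] H} {ρ : H →L[ℂ] H} (hρ : ρ.IsPositive)
    (hQ : ∀ᶠ t in 𝓝[>] 0, (Q t).IsPositive) (h : Tendsto Q (𝓝[>] 0) (𝓝 ρ)) :
    Tendsto (fun t => cfc Real.negMulLog (Q t)) (𝓝[>] 0) (𝓝 (cfc Real.negMulLog ρ)) := by
  have h1 : ∀ᶠ t in 𝓝[>] 0, ‖Q t‖ ≤ ‖ρ‖ + 1 :=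
    (h.norm.eventually_lt_const (lt_add_one _)).mono fun t ht => ht.le
  refine h.cfc (isCompact_Icc (a := (0 : ℝ)) (b := ‖ρ‖ + 1)) Real.negMulLog ?_ ?_ ?_
    hρ.isSelfAdjoint Real.continuous_negMulLog.continuousOn
  · filter_upwards [hQ, h1] with t ht1 ht2 using spectrum_subset_Icc ht1 ht2
  · filter_upwards [hQ] with t ht using ht.isSelfAdjoint
  · exact spectrum_subset_Icc hρ (by linarith)

/-- Replacing `ρ` by `Q t` costs `O(t |ln t|)`, and `Q t * negLogAdd (t ^ 2) (Q t)` is within `t²`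
of `-Q t ln Q t`, which converges by continuity of the functional calculus. The limit exists even
where `ρ` is singular. -/
theorem tendsto_mul_negLogAdd {Q : ℝ → H →L[ℂ] H} {ρ : H →L[ℂ] H} (hρ : ρ.IsPositive)
    (hQ : ∀ᶠ t in 𝓝[>] 0, (Q t).IsPositive) (hO : (fun t => Q t - ρ) =O[𝓝[>] 0] fun t => t) :
    Tendsto (fun t => ρ * negLogAdd (t ^ 2) (Q t)) (𝓝[>] 0) (𝓝 (cfc Real.negMulLog ρ)) := by
  have h1 := tendsto_mul_negLogAdd_of_isBigO hQ hO hO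
  have h2 : Tendsto (fun t => Q t * negLogAdd (t ^ 2) (Q t) - cfc Real.negMulLog (Q t))
      (𝓝[>] 0) (𝓝 0) := by
    have h3 : Tendsto (fun t : ℝ => t ^ 2) (𝓝[>] 0) (𝓝 0) := by
      have : Tendsto (fun t : ℝ => t ^ 2) (𝓝 0) (𝓝 (0 ^ 2)) := (continuous_pow 2).tendsto 0
      rw [zero_pow two_ne_zero] at this
      exact tendsto_nhdsWithin_of_tendsto_nhds this
    refine squeeze_zero_norm' ?_ h3
    filter_upwards [hQ, self_mem_nhdsWithin] with t ht1 ht2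
    exact norm_mul_negLogAdd_sub_le ht1 (pow_pos ht2 2)
  have h4 := (h2.add (tendsto_cfc_negMulLog hρ hQ (tendsto_of_isBigO_id hO))).sub h1
  simp only [zero_add, sub_zero] at h4
  exact h4.congr fun t => by rw [sub_mul]; abel

/-- The generator `X ↦ a X a† - (a†a X + X a†a) / 2`. -/
def lindblad (a X : H →L[ℂ] H) : H →L[ℂ] H :=
  a * X * star a - (2⁻¹ : ℝ) • (star a * a * X + X * (star a * a))

theorem reTrace_lindblad (a X : H →L[ℂ] H) : reTrace (lindblad a X) = 0 := by
  rw [lindblad, reTrace_sub, reTrace_smul, reTrace_add, reTrace_mul_comm X, mul_assoc,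
    reTrace_mul_comm a, mul_assoc, reTrace_mul_comm X]
  ring

theorem re_inner_star_mul_mul (a Λ : H →L[ℂ] H) (v : H) :
    (⟪v, (star a * Λ * a) v⟫_ℂ).re = (⟪a v, Λ (a v)⟫_ℂ).re := by
  rw [mul_apply_eq_comp, mul_apply_eq_comp, ContinuousLinearMap.star_eq_adjoint,
    ContinuousLinearMap.adjoint_inner_right]

/-- In the second part `Λ` occurs only next to `ρ`, and such products converge. Whether the trace
converges or diverges is decided by the jump terms `⟪a (b i), Λ (a (b i))⟫`. -/
theorem reTrace_lindblad_mul {ρ : H →L[ℂ] H} {b : OrthonormalBasis ι ℂ H} {p : ι → ℝ}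
    (hb : ∀ i, ρ (b i) = (p i : ℂ) • b i) (a Λ : H →L[ℂ] H) :
    reTrace (lindblad a ρ * Λ) = ∑ i, p i * (⟪a (b i), Λ (a (b i))⟫_ℂ).re -
      2⁻¹ * (reTrace (star a * a * (ρ * Λ)) + reTrace (star a * a * (Λ * ρ))) := by
  have h1 : reTrace (a * ρ * star a * Λ) = ∑ i, p i * (⟪a (b i), Λ (a (b i))⟫_ℂ).re := by
    rw [mul_assoc, mul_assoc, reTrace_mul_comm a, mul_assoc, reTrace_mul_comm ρ,
      reTrace_mul_of_eigenbasis hb]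
    simp only [re_inner_star_mul_mul]
  rw [lindblad, sub_mul, reTrace_sub, h1, smul_mul_assoc, reTrace_smul, add_mul, reTrace_add,
    mul_assoc ρ, reTrace_mul_comm ρ, mul_assoc, mul_assoc (star a * a) Λ ρ]

theorem tendsto_mul_of_tendsto_mul {ρ K : H →L[ℂ] H} {Λ : ℝ → H →L[ℂ] H} {l : Filter ℝ}
    (hρ : IsSelfAdjoint ρ) (hK : IsSelfAdjoint K) (hΛ : ∀ t, IsSelfAdjoint (Λ t))
    (h : Tendsto (fun t => ρ * Λ t) l (𝓝 K)) : Tendsto (fun t => Λ t * ρ) l (𝓝 K) := by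
  have := h.star
  rw [hK.star_eq] at this
  exact this.congr fun t => by rw [star_mul, hρ.star_eq, (hΛ t).star_eq]

theorem tendsto_drift {ρ : H →L[ℂ] H} (hρ : ρ.IsPositive) {Λ : ℝ → H →L[ℂ] H} {l : Filter ℝ}
    {b : OrthonormalBasis ι ℂ H} {p : ι → ℝ} (hb : ∀ i, ρ (b i) = (p i : ℂ) • b i)
    (hΛ : ∀ t, IsSelfAdjoint (Λ t)) (h : Tendsto (fun t => ρ * Λ t) l (𝓝 (cfc Real.negMulLog ρ)))
    (a : H →L[ℂ] H) :
    Tendsto (fun t => 2⁻¹ * (reTrace (star a * a * (ρ * Λ t)) + reTrace (star a * a * (Λ t * ρ))))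
      l (𝓝 (∑ i, Real.negMulLog (p i) * ‖a (b i)‖ ^ 2)) := by
  have h2 := tendsto_mul_of_tendsto_mul hρ.isSelfAdjoint (cfc_predicate _ ρ) hΛ h
  have h3 := ((continuous_reTrace.tendsto _).comp (h.const_mul (star a * a))).add
    ((continuous_reTrace.tendsto _).comp (h2.const_mul (star a * a)))
  have h4 := h3.const_mul (2⁻¹ : ℝ)
  have e : (2⁻¹ : ℝ) * (reTrace (star a * a * cfc Real.negMulLog ρ) +
      reTrace (star a * a * cfc Real.negMulLog ρ)) =
      ∑ i, Real.negMulLog (p i) * ‖a (b i)‖ ^ 2 := by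
    rw [← two_mul, inv_mul_cancel_left₀ two_ne_zero,
      reTrace_mul_of_eigenbasis (cfc_apply_eigenbasis hρ.isSelfAdjoint hb _)]
    refine Finset.sum_congr rfl fun i _ => ?_
    have := re_inner_star_mul_mul a 1 (b i)
    rw [mul_one] at this
    rw [this, one_apply_eq_self, inner_self_eq_norm_sq_to_K]
    norm_cast
  rw [e] at h4
  exact h4

/-- The hypothesis on `x` says that `x = ρ w`. Then `⟪x, Λ x⟫ = ⟪w, ρ Λ ρ w⟫`, in which only the
convergent product `ρ Λ` appears. -/
theorem tendsto_re_inner_of_range {ρ : H →L[ℂ] H} (hρ : ρ.IsPositive) {Λ : ℝ → H →L[ℂ] H}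
    {l : Filter ℝ} {b : OrthonormalBasis ι ℂ H} {p : ι → ℝ}
    (hb : ∀ i, ρ (b i) = (p i : ℂ) • b i)
    (h : Tendsto (fun t => ρ * Λ t) l (𝓝 (cfc Real.negMulLog ρ)))
    {x : H} (hx : ∀ i, p i = 0 → ⟪b i, x⟫_ℂ = 0) :
    Tendsto (fun t => (⟪x, Λ t x⟫_ℂ).re) l (𝓝 (∑ i, -Real.log (p i) * ‖⟪b i, x⟫_ℂ‖ ^ 2)) := by
  -- On the kernel of `ρ` the default value `0⁻¹ = 0` is consistent with `hx`.
  set w : H := ∑ i, ((p i)⁻¹ : ℂ) • ⟪b i, x⟫_ℂ • b i with hw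
  have hwx : ρ w = x := by
    conv_rhs => rw [← b.sum_repr' x]
    rw [hw, map_sum]
    refine Finset.sum_congr rfl fun i _ => ?_
    rw [map_smul, map_smul, hb]
    rcases eq_or_ne (p i) 0 with h0 | h0
    · simp [hx i h0]
    · rw [smul_comm _ (p i : ℂ), smul_smul, inv_mul_cancel₀ (Complex.ofReal_ne_zero.2 h0), one_smul]
  have h1 : ∀ t, (⟪x, Λ t x⟫_ℂ).re = (⟪w, (ρ * Λ t) (ρ w)⟫_ℂ).re := fun t => by
    have : ⟪ρ w, Λ t x⟫_ℂ = ⟪w, ρ (Λ t x)⟫_ℂ := hρ.isSelfAdjoint.isSymmetric w (Λ t x)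
    rw [mul_apply_eq_comp, hwx, ← this, hwx]
  have h2 : Tendsto (fun t => (⟪w, (ρ * Λ t) (ρ w)⟫_ℂ).re) l
      (𝓝 (⟪w, cfc Real.negMulLog ρ (ρ w)⟫_ℂ).re) := by
    have hc : Continuous fun T : H →L[ℂ] H => (⟪w, T (ρ w)⟫_ℂ).re := by fun_prop
    exact (hc.tendsto _).comp h
  have h3 : (⟪w, cfc Real.negMulLog ρ (ρ w)⟫_ℂ).re = ∑ i, -Real.log (p i) * ‖⟪b i, x⟫_ℂ‖ ^ 2 := by
    have hη := cfc_apply_eigenbasis hρ.isSelfAdjoint hb Real.negMulLog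
    have h4 : ∀ i, (cfc Real.negMulLog ρ * ρ) (b i) = ((Real.negMulLog (p i) * p i : ℝ) : ℂ) • b i := by
      intro i
      rw [mul_apply_eq_comp, hb, map_smul, hη, smul_smul, mul_comm, Complex.ofReal_mul]
    have h5 := re_inner_apply_of_eigenbasis h4 w
    rw [mul_apply_eq_comp] at h5
    rw [h5]
    refine Finset.sum_congr rfl fun i _ => ?_
    have h6 : ⟪b i, x⟫_ℂ = p i * ⟪b i, w⟫_ℂ := by
      have : ⟪ρ (b i), w⟫_ℂ = ⟪b i, ρ w⟫_ℂ := hρ.isSelfAdjoint.isSymmetric (b i) w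
      rw [← hwx, ← this, hb, inner_smul_left, Complex.conj_ofReal]
    rw [h6, norm_mul, mul_pow, Complex.norm_real, Real.norm_eq_abs, sq_abs, Real.negMulLog]
    ring
  rw [← h3]
  exact h2.congr fun t => (h1 t).symm

/-- The entropy production `∑ p i |⟨b j, a b i⟩|² (ln p i - ln p j)`. -/
def entropyFlow (a : H →L[ℂ] H) (b : OrthonormalBasis ι ℂ H) (p : ι → ℝ) : ℝ :=
  ∑ i, ∑ j, p i * ‖⟪b j, a (b i)⟫_ℂ‖ ^ 2 * (Real.log (p i) - Real.log (p j))

theorem tendsto_reTrace_lindblad_mul {ρ : H →L[ℂ] H} (hρ : ρ.IsPositive) {Λ : ℝ → H →L[ℂ] H}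
    {l : Filter ℝ} {b : OrthonormalBasis ι ℂ H} {p : ι → ℝ}
    (hb : ∀ i, ρ (b i) = (p i : ℂ) • b i) (hΛ : ∀ t, IsSelfAdjoint (Λ t))
    (h : Tendsto (fun t => ρ * Λ t) l (𝓝 (cfc Real.negMulLog ρ))) {a : H →L[ℂ] H}
    (hleak : ∀ i j, p j = 0 → p i * ‖⟪b j, a (b i)⟫_ℂ‖ ^ 2 = 0) :
    Tendsto (fun t => reTrace (lindblad a ρ * Λ t)) l (𝓝 (entropyFlow a b p)) := by
  have h1 : Tendsto (fun t => ∑ i, p i * (⟪a (b i), Λ t (a (b i))⟫_ℂ).re) l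
      (𝓝 (∑ i, p i * ∑ j, -Real.log (p j) * ‖⟪b j, a (b i)⟫_ℂ‖ ^ 2)) := by
    refine tendsto_finsetSum _ fun i _ => ?_
    rcases eq_or_ne (p i) 0 with h0 | h0
    · simpa [h0] using tendsto_const_nhds
    · refine (tendsto_re_inner_of_range hρ hb h fun j hj => ?_).const_mul _
      have := (mul_eq_zero.1 (hleak i j hj)).resolve_left h0
      exact norm_eq_zero.1 (pow_eq_zero_iff two_ne_zero |>.1 this)
  have h2 := h1.sub (tendsto_drift hρ hb hΛ h a)
  have e : ∑ i, p i * ∑ j, -Real.log (p j) * ‖⟪b j, a (b i)⟫_ℂ‖ ^ 2 -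
      ∑ i, Real.negMulLog (p i) * ‖a (b i)‖ ^ 2 = entropyFlow a b p := by
    rw [entropyFlow, ← Finset.sum_sub_distrib]
    refine Finset.sum_congr rfl fun i _ => ?_
    rw [← b.sum_sq_norm_inner_right (a (b i)), Finset.mul_sum, Finset.mul_sum,
      ← Finset.sum_sub_distrib]
    refine Finset.sum_congr rfl fun j _ => ?_
    rw [Real.negMulLog]
    ring
  rw [e] at h2
  exact h2.congr fun t => (reTrace_lindblad_mul hb a (Λ t)).symm

end FiniteDim

/-! ### Divergence of the entropy production when the support leaks. -/

section FiniteDim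

variable {H : Type*} [NormedAddCommGroup H] [InnerProductSpace ℂ H] [FiniteDimensional ℂ H]
  [CompleteSpace H] {ι : Type*} [Fintype ι]

/-- The convex function `-ln` lies above its tangent at `t`; this is applied to each eigenvalue of
`Q + t²`. When `⟪v, Q v⟫ = O(t)`, the subtracted quotient stays bounded and `-ln t` remains. -/
theorem le_re_inner_negLogAdd_of_pos {Q : H →L[ℂ] H} (hQ : Q.IsPositive) {t : ℝ} (ht : 0 < t)
    (v : H) :
    (1 - Real.log t) * ‖v‖ ^ 2 - ((⟪v, Q v⟫_ℂ).re + t ^ 2 * ‖v‖ ^ 2) / t ≤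
      (⟪v, negLogAdd (t ^ 2) Q v⟫_ℂ).re := by
  obtain ⟨c, q, -, hc⟩ := exists_eigenbasis hQ.isSelfAdjoint
  have hq := eigenvalue_nonneg hQ hc
  rw [negLogAdd, re_inner_apply_of_eigenbasis (cfc_apply_eigenbasis hQ.isSelfAdjoint hc _),
    re_inner_apply_of_eigenbasis hc, ← c.sum_sq_norm_inner_right v, Finset.mul_sum, Finset.mul_sum,
    ← Finset.sum_add_distrib, Finset.sum_div, ← Finset.sum_sub_distrib]
  refine Finset.sum_le_sum fun j _ => ?_
  have h0 : 0 < q j + t ^ 2 := add_pos_of_nonneg_of_pos (hq j) (by positivity)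
  have h1 := Real.log_le_sub_one_of_pos (div_pos h0 ht)
  rw [Real.log_div h0.ne' ht.ne'] at h1
  have h2 : 1 - Real.log t - (q j + t ^ 2) / t ≤ -Real.log (q j + t ^ 2) := by linarith
  calc _ = (1 - Real.log t - (q j + t ^ 2) / t) * ‖⟪c j, v⟫_ℂ‖ ^ 2 := by ring
    _ ≤ _ := mul_le_mul_of_nonneg_right h2 (sq_nonneg _)

theorem le_re_inner_negLogAdd {Q : H →L[ℂ] H} (hQ : Q.IsPositive) {C t : ℝ} (hC : ‖Q‖ ≤ C)
    (ht : 0 < t) (ht1 : t ≤ 1) (v : H) :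
    0 ≤ (⟪v, negLogAdd (t ^ 2) Q v⟫_ℂ).re + Real.log (C + 1) * ‖v‖ ^ 2 := by
  obtain ⟨c, q, -, hc⟩ := exists_eigenbasis hQ.isSelfAdjoint
  have hq := eigenvalue_nonneg hQ hc
  rw [negLogAdd, re_inner_apply_of_eigenbasis (cfc_apply_eigenbasis hQ.isSelfAdjoint hc _),
    ← c.sum_sq_norm_inner_right v, Finset.mul_sum, ← Finset.sum_add_distrib]
  refine Finset.sum_nonneg fun j _ => ?_
  have h0 : 0 < q j + t ^ 2 := add_pos_of_nonneg_of_pos (hq j) (by positivity)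
  have h1 : q j ≤ C := by
    have h2 := Q.le_opNorm (c j)
    rw [hc, norm_smul, Complex.norm_real, Real.norm_of_nonneg (hq j)] at h2
    simp only [c.norm_eq_one, mul_one] at h2
    exact h2.trans hC
  have h2 : Real.log (q j + t ^ 2) ≤ Real.log (C + 1) := Real.log_le_log h0 (by nlinarith)
  rw [← add_mul]
  exact mul_nonneg (by linarith) (sq_nonneg _)

/-- `Q` need not respect the splitting into `x` and `y`, so cross terms are not controlled directly.
The form `N v = ⟪v, Λ v⟫ + ln (C + 1) ‖v‖²` is non-negative, and the parallelogram law gives `N y ≤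
N y + N (2 x + y) = 2 N (x + y) + 2 N x`. -/
theorem le_re_inner_negLogAdd_add {Q : H →L[ℂ] H} (hQ : Q.IsPositive) {C t : ℝ} (hC : ‖Q‖ ≤ C)
    (ht : 0 < t) (ht1 : t ≤ 1) (x y : H) :
    ((⟪y, negLogAdd (t ^ 2) Q y⟫_ℂ).re + Real.log (C + 1) * ‖y‖ ^ 2) / 2 -
        ((⟪x, negLogAdd (t ^ 2) Q x⟫_ℂ).re + Real.log (C + 1) * ‖x‖ ^ 2) ≤
      (⟪x + y, negLogAdd (t ^ 2) Q (x + y)⟫_ℂ).re + Real.log (C + 1) * ‖x + y‖ ^ 2 := by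
  have h := le_re_inner_negLogAdd hQ hC ht ht1 (x + y + x)
  have h1 : ‖x + y + x‖ ^ 2 = 2 * ‖x + y‖ ^ 2 + 2 * ‖x‖ ^ 2 - ‖y‖ ^ 2 := by
    have := parallelogram_law_with_norm ℂ (x + y) x
    rw [show x + y - x = y by abel] at this
    linear_combination this
  rw [h1] at h
  simp only [map_add, inner_add_left, inner_add_right, Complex.add_re] at h ⊢
  linarith

/-- Split `x = x₀ + x₁` along the range and the kernel of `ρ`. The form converges at `x₀`. At `x₁ ≠
0` it diverges like `|ln t|` at least, because `⟪x₁, Q t x₁⟫ = ⟪x₁, (Q t - ρ) x₁⟫ = O(t)`. -/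
theorem tendsto_re_inner_atTop {Q : ℝ → H →L[ℂ] H} {ρ : H →L[ℂ] H} (hρ : ρ.IsPositive)
    (hQ : ∀ᶠ t in 𝓝[>] 0, (Q t).IsPositive) (hO : (fun t => Q t - ρ) =O[𝓝[>] 0] fun t => t)
    {b : OrthonormalBasis ι ℂ H} {p : ι → ℝ} (hb : ∀ i, ρ (b i) = (p i : ℂ) • b i)
    {x : H} {j : ι} (hj : p j = 0) (hx : ⟪b j, x⟫_ℂ ≠ 0) :
    Tendsto (fun t => (⟪x, negLogAdd (t ^ 2) (Q t) x⟫_ℂ).re) (𝓝[>] 0) atTop := by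
  classical
  set x₀ : H := ∑ i, if p i = 0 then 0 else ⟪b i, x⟫_ℂ • b i with hx₀
  set x₁ : H := ∑ i, if p i = 0 then ⟪b i, x⟫_ℂ • b i else 0 with hx₁
  have hsum : x₀ + x₁ = x := by
    rw [hx₀, hx₁, ← Finset.sum_add_distrib]
    conv_rhs => rw [← b.sum_repr' x]
    exact Finset.sum_congr rfl fun i _ => by split_ifs <;> simp
  have hite : ∀ (i k : ι), ⟪b k, ⟪b i, x⟫_ℂ • b i⟫_ℂ = if i = k then ⟪b k, x⟫_ℂ else 0 := by
    intro i k
    rw [inner_smul_right, orthonormal_iff_ite.1 b.orthonormal]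
    by_cases h : i = k
    · simp [h]
    · simp [h, Ne.symm h]
  have h0 : ∀ i, p i = 0 → ⟪b i, x₀⟫_ℂ = 0 := by
    intro i hi
    rw [hx₀, inner_sum]
    refine Finset.sum_eq_zero fun k _ => ?_
    split_ifs with hk
    · simp
    · rw [hite, if_neg]
      rintro rfl
      exact hk hi
  have h1 : x₁ ≠ 0 := by
    intro h
    have h2 : ⟪b j, x⟫_ℂ = ⟪b j, x₀⟫_ℂ + ⟪b j, x₁⟫_ℂ := by rw [← inner_add_right, hsum]
    rw [h0 j hj, h, inner_zero_right, add_zero] at h2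
    exact hx h2
  have hρ1 : ρ x₁ = 0 := by
    rw [hx₁, map_sum]
    refine Finset.sum_eq_zero fun k _ => ?_
    split_ifs with hk
    · rw [map_smul, hb, hk]
      simp
    · simp
  have hb0 := tendsto_re_inner_of_range hρ hb (tendsto_mul_negLogAdd hρ hQ hO) h0
  set B := ∑ i, -Real.log (p i) * ‖⟪b i, x₀⟫_ℂ‖ ^ 2
  obtain ⟨C, hC⟩ := hO.bound
  set κ := Real.log (‖ρ‖ + 1 + 1)
  have e1 : ∀ᶠ t in 𝓝[>] 0, ‖Q t‖ ≤ ‖ρ‖ + 1 :=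
    ((tendsto_of_isBigO_id hO).norm.eventually_lt_const (lt_add_one _)).mono fun t ht => ht.le
  have e2 : ∀ᶠ t in 𝓝[>] (0 : ℝ), t ∈ Set.Ioc (0 : ℝ) 1 := Ioc_mem_nhdsGT one_pos
  have e3 := hb0.eventually_lt_const (lt_add_one B)
  have hlog : Tendsto (fun t : ℝ => ‖x₁‖ ^ 2 / 2 * -Real.log t +
      (‖x₁‖ ^ 2 * (-C) / 2 + κ * ‖x₁‖ ^ 2 / 2 - (B + 1 + κ * ‖x₀‖ ^ 2) - κ * ‖x‖ ^ 2))
      (𝓝[>] 0) atTop := by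
    refine tendsto_atTop_add_const_right _ _ (Tendsto.const_mul_atTop ?_ ?_)
    · have := norm_pos_iff.2 h1
      positivity
    · exact tendsto_neg_atBot_atTop.comp Real.tendsto_log_nhdsGT_zero
  refine tendsto_atTop_mono' _ ?_ hlog
  filter_upwards [hQ, hC, e1, e2, e3] with t t1 t2 t3 t4 t5
  have k1 := le_re_inner_negLogAdd_add t1 t3 t4.1 t4.2 x₀ x₁
  rw [hsum] at k1
  have k2 := le_re_inner_negLogAdd_of_pos t1 t4.1 x₁
  have k3 : (⟪x₁, Q t x₁⟫_ℂ).re ≤ C * t * ‖x₁‖ ^ 2 := by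
    have k4 : ⟪x₁, Q t x₁⟫_ℂ = ⟪x₁, (Q t - ρ) x₁⟫_ℂ := by rw [sub_apply, hρ1, sub_zero]
    rw [k4]
    rw [Real.norm_of_nonneg t4.1.le] at t2
    calc _ ≤ ‖⟪x₁, (Q t - ρ) x₁⟫_ℂ‖ := (le_abs_self _).trans (Complex.abs_re_le_norm _)
      _ ≤ ‖x₁‖ * ‖(Q t - ρ) x₁‖ := norm_inner_le_norm _ _
      _ ≤ ‖x₁‖ * (C * t * ‖x₁‖) := by
          gcongr
          exact ((Q t - ρ).le_opNorm _).trans (by gcongr)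
      _ = _ := by ring
  have k5 : ((⟪x₁, Q t x₁⟫_ℂ).re + t ^ 2 * ‖x₁‖ ^ 2) / t ≤ C * ‖x₁‖ ^ 2 + ‖x₁‖ ^ 2 := by
    rw [div_le_iff₀ t4.1]
    have : t ^ 2 * ‖x₁‖ ^ 2 ≤ t * ‖x₁‖ ^ 2 := by
      gcongr
      nlinarith [t4.1, t4.2]
    nlinarith
  simp only [κ] at *
  linarith

theorem tendsto_reTrace_lindblad_mul_atTop {Q : ℝ → H →L[ℂ] H} {ρ : H →L[ℂ] H}
    (hρ : ρ.IsPositive) (hQ : ∀ᶠ t in 𝓝[>] 0, (Q t).IsPositive)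
    (hO : (fun t => Q t - ρ) =O[𝓝[>] 0] fun t => t)
    {b : OrthonormalBasis ι ℂ H} {p : ι → ℝ} (hb : ∀ i, ρ (b i) = (p i : ℂ) • b i)
    {a : H →L[ℂ] H} {i j : ι} (hj : p j = 0) (hleak : p i * ‖⟪b j, a (b i)⟫_ℂ‖ ^ 2 ≠ 0) :
    Tendsto (fun t => reTrace (lindblad a ρ * negLogAdd (t ^ 2) (Q t))) (𝓝[>] 0) atTop := by
  classical
  have hp := eigenvalue_nonneg hρ hb
  have hpi : 0 < p i := (hp i).lt_of_ne' (left_ne_zero_of_mul hleak)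
  have hij : ⟪b j, a (b i)⟫_ℂ ≠ 0 := by
    intro h
    simp [h] at hleak
  have h1 := (tendsto_re_inner_atTop hρ hQ hO hb hj hij).const_mul_atTop hpi
  have h2 := tendsto_drift hρ hb (fun t => isSelfAdjoint_negLogAdd (t ^ 2) (Q t))
    (tendsto_mul_negLogAdd hρ hQ hO) a
  set κ := Real.log (‖ρ‖ + 1 + 1) with hκ
  have h3 : Tendsto (fun t => ∑ k, p k * (⟪a (b k), negLogAdd (t ^ 2) (Q t) (a (b k))⟫_ℂ).re)
      (𝓝[>] 0) atTop := by
    have h4 := tendsto_atTop_add_const_right (𝓝[>] (0 : ℝ))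
      (∑ k ∈ Finset.univ.erase i, p k * -(κ * ‖a (b k)‖ ^ 2)) h1
    refine tendsto_atTop_mono' _ ?_ h4
    have e1 : ∀ᶠ t in 𝓝[>] 0, ‖Q t‖ ≤ ‖ρ‖ + 1 :=
      ((tendsto_of_isBigO_id hO).norm.eventually_lt_const (lt_add_one _)).mono fun t ht => ht.le
    have e2 : ∀ᶠ t in 𝓝[>] (0 : ℝ), t ∈ Set.Ioc (0 : ℝ) 1 := Ioc_mem_nhdsGT one_pos
    filter_upwards [hQ, e1, e2] with t t1 t2 t3
    rw [← Finset.add_sum_erase _ _ (Finset.mem_univ i)]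
    gcongr with k hk
    · exact hp k
    · have := le_re_inner_negLogAdd t1 t2 t3.1 t3.2 (a (b k))
      linarith
  exact (h3.atTop_add h2.neg).congr fun t => by
    rw [reTrace_lindblad_mul hb, sub_eq_add_neg]

/-- Klein's inequality for `(A, B)` and for `(B, A)`. The regularised logarithm underestimates the
entropy of its own operator, so the diagonal terms go the right way. -/
theorem reTrace_negMulLog_sub_bounds {A B : H →L[ℂ] H} (hA : A.IsPositive) (hB : B.IsPositive)
    {δ : ℝ} (hδ : 0 < δ) :
    reTrace ((B - A) * negLogAdd δ B) - reTrace (B - A) - δ * Module.finrank ℂ H ≤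
        reTrace (cfc Real.negMulLog B) - reTrace (cfc Real.negMulLog A) ∧
      reTrace (cfc Real.negMulLog B) - reTrace (cfc Real.negMulLog A) ≤
        reTrace ((B - A) * negLogAdd δ A) - reTrace (B - A) + δ * Module.finrank ℂ H := by
  have h1 := reTrace_negMulLog_le hA hB hδ
  have h2 := reTrace_negMulLog_le hB hA hδ
  have h3 := reTrace_mul_negLogAdd_le hA hδ
  have h4 := reTrace_mul_negLogAdd_le hB hδ
  simp only [sub_mul, reTrace_sub]
  constructor <;> linarith

/-! ### The difference quotient of the entropy. -/

section Evolution

variable {R : ℝ → H →L[ℂ] H} {ρ a : H →L[ℂ] H}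

theorem isBigO_sub_of_isBigO_sq
    (hR : (fun t => R t - ρ - t • lindblad a ρ) =O[𝓝[>] 0] fun t => t ^ 2) :
    (fun t => R t - ρ) =O[𝓝[>] 0] fun t => t := by
  have h1 : (fun t : ℝ => t • lindblad a ρ) =O[𝓝[>] 0] fun t => t := by
    refine Asymptotics.IsBigO.of_bound ‖lindblad a ρ‖ (Eventually.of_forall fun t => ?_)
    rw [norm_smul, mul_comm]
  have h2 : (fun t : ℝ => t ^ 2) =O[𝓝[>] 0] fun t => t := by
    refine Asymptotics.IsBigO.of_bound 1 ?_
    have e2 : ∀ᶠ t in 𝓝[>] (0 : ℝ), t ∈ Set.Ioc (0 : ℝ) 1 := Ioc_mem_nhdsGT one_pos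
    filter_upwards [e2] with t ht
    rw [Real.norm_of_nonneg (sq_nonneg t), Real.norm_of_nonneg ht.1.le]
    nlinarith [ht.1, ht.2]
  exact ((hR.trans h2).add h1).congr_left fun t => by abel

/-- The error of the difference quotient. -/
def quotientError (R : ℝ → H →L[ℂ] H) (ρ a : H →L[ℂ] H) (t : ℝ) : H →L[ℂ] H :=
  t⁻¹ • (R t - ρ) - lindblad a ρ

theorem isBigO_quotientError
    (hR : (fun t => R t - ρ - t • lindblad a ρ) =O[𝓝[>] 0] fun t => t ^ 2) :
    quotientError R ρ a =O[𝓝[>] 0] fun t => t := by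
  obtain ⟨C, hC⟩ := hR.bound
  refine Asymptotics.IsBigO.of_bound C ?_
  filter_upwards [hC, self_mem_nhdsWithin] with t t1 t2
  have t2 : 0 < t := t2
  have e : quotientError R ρ a t = t⁻¹ • (R t - ρ - t • lindblad a ρ) := by
    rw [quotientError, smul_sub t⁻¹ (R t - ρ), smul_smul, inv_mul_cancel₀ t2.ne', one_smul]
  rw [e, norm_smul, norm_inv, inv_mul_le_iff₀ (norm_pos_iff.2 t2.ne')]
  rw [norm_pow] at t1
  linarith

theorem tendsto_correction (hR : (fun t => R t - ρ - t • lindblad a ρ) =O[𝓝[>] 0] fun t => t ^ 2)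
    {Q : ℝ → H →L[ℂ] H} (hQ : ∀ᶠ t in 𝓝[>] 0, (Q t).IsPositive)
    (hO : (fun t => Q t - ρ) =O[𝓝[>] 0] fun t => t) (c : ℝ) :
    Tendsto (fun t => reTrace (quotientError R ρ a t * negLogAdd (t ^ 2) (Q t)) -
      reTrace (quotientError R ρ a t) + t * c) (𝓝[>] 0) (𝓝 0) := by
  have hz : reTrace (0 : H →L[ℂ] H) = 0 := by simp [reTrace]
  have hE := isBigO_quotientError hR
  have ht : Tendsto (fun t : ℝ => t) (𝓝[>] 0) (𝓝 0) :=
    tendsto_nhdsWithin_of_tendsto_nhds tendsto_id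
  have h1 := (continuous_reTrace.tendsto _).comp (tendsto_mul_negLogAdd_of_isBigO hQ hO hE)
  have h2 := (continuous_reTrace.tendsto _).comp (hE.trans_tendsto ht)
  have h3 := (h1.sub h2).add (ht.mul_const c)
  rw [hz, sub_zero, zero_mul, add_zero] at h3
  exact h3

theorem difference_quotient_bounds (hρ : ρ.IsPositive) {t : ℝ} (hRt : (R t).IsPositive)
    (ht : 0 < t) :
    reTrace (lindblad a ρ * negLogAdd (t ^ 2) (R t)) +
        (reTrace (quotientError R ρ a t * negLogAdd (t ^ 2) (R t)) -
          reTrace (quotientError R ρ a t) + t * -Module.finrank ℂ H) ≤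
      (reTrace (cfc Real.negMulLog (R t)) - reTrace (cfc Real.negMulLog ρ)) / t ∧
    (reTrace (cfc Real.negMulLog (R t)) - reTrace (cfc Real.negMulLog ρ)) / t ≤
      reTrace (lindblad a ρ * negLogAdd (t ^ 2) ρ) +
        (reTrace (quotientError R ρ a t * negLogAdd (t ^ 2) ρ) -
          reTrace (quotientError R ρ a t) + t * Module.finrank ℂ H) := by
  have e1 : R t - ρ = t • (lindblad a ρ + quotientError R ρ a t) := by
    rw [quotientError, add_sub_cancel, smul_smul, mul_inv_cancel₀ ht.ne', one_smul]
  obtain ⟨h1, h2⟩ := reTrace_negMulLog_sub_bounds hρ hRt (show 0 < t ^ 2 by positivity)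
  simp only [e1, smul_mul_assoc, reTrace_smul, add_mul, reTrace_add, reTrace_lindblad,
    zero_add] at h1 h2
  rw [le_div_iff₀ ht, div_le_iff₀ ht]
  constructor <;> linarith

theorem tendsto_difference_quotient (hρ : ρ.IsPositive) (hRp : ∀ t, 0 < t → (R t).IsPositive)
    (hR : (fun t => R t - ρ - t • lindblad a ρ) =O[𝓝[>] 0] fun t => t ^ 2)
    {b : OrthonormalBasis ι ℂ H} {p : ι → ℝ} (hb : ∀ i, ρ (b i) = (p i : ℂ) • b i)
    (hleak : ∀ i j, p j = 0 → p i * ‖⟪b j, a (b i)⟫_ℂ‖ ^ 2 = 0) :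
    Tendsto (fun t => (reTrace (cfc Real.negMulLog (R t)) - reTrace (cfc Real.negMulLog ρ)) / t)
      (𝓝[>] 0) (𝓝 (entropyFlow a b p)) := by
  have hQ : ∀ᶠ t in 𝓝[>] 0, (R t).IsPositive := by
    filter_upwards [self_mem_nhdsWithin] with t ht using hRp t ht
  -- For the upper bound, the constant family `ρ` takes the place of `R`.
  have hQ' : ∀ᶠ t : ℝ in 𝓝[>] 0, ρ.IsPositive := Eventually.of_forall fun _ => hρ
  have hO := isBigO_sub_of_isBigO_sq hR
  have hO' : (fun _ : ℝ => ρ - ρ) =O[𝓝[>] 0] fun t : ℝ => t := by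
    simpa using Asymptotics.isBigO_zero _ _
  have l1 := (tendsto_reTrace_lindblad_mul hρ hb (fun t => isSelfAdjoint_negLogAdd (t ^ 2) (R t))
    (tendsto_mul_negLogAdd hρ hQ hO) hleak).add
    (tendsto_correction hR hQ hO (-Module.finrank ℂ H))
  have l2 := (tendsto_reTrace_lindblad_mul hρ hb (fun t => isSelfAdjoint_negLogAdd (t ^ 2) ρ)
    (tendsto_mul_negLogAdd hρ hQ' hO') hleak).add
    (tendsto_correction hR hQ' hO' (Module.finrank ℂ H))
  rw [add_zero] at l1 l2
  refine tendsto_of_tendsto_of_tendsto_of_le_of_le' l1 l2 ?_ ?_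
  · filter_upwards [self_mem_nhdsWithin] with t ht
    exact (difference_quotient_bounds hρ (hRp t ht) ht).1
  · filter_upwards [self_mem_nhdsWithin] with t ht
    exact (difference_quotient_bounds hρ (hRp t ht) ht).2

theorem tendsto_difference_quotient_atTop (hρ : ρ.IsPositive)
    (hRp : ∀ t, 0 < t → (R t).IsPositive)
    (hR : (fun t => R t - ρ - t • lindblad a ρ) =O[𝓝[>] 0] fun t => t ^ 2)
    {b : OrthonormalBasis ι ℂ H} {p : ι → ℝ} (hb : ∀ i, ρ (b i) = (p i : ℂ) • b i)
    {i j : ι} (hj : p j = 0) (hleak : p i * ‖⟪b j, a (b i)⟫_ℂ‖ ^ 2 ≠ 0) :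
    Tendsto (fun t => (reTrace (cfc Real.negMulLog (R t)) - reTrace (cfc Real.negMulLog ρ)) / t)
      (𝓝[>] 0) atTop := by
  have hQ : ∀ᶠ t in 𝓝[>] 0, (R t).IsPositive := by
    filter_upwards [self_mem_nhdsWithin] with t ht using hRp t ht
  have hO := isBigO_sub_of_isBigO_sq hR
  refine tendsto_atTop_mono' _ ?_ ((tendsto_reTrace_lindblad_mul_atTop hρ hQ hO hb hj hleak).atTop_add
    (tendsto_correction hR hQ hO (-Module.finrank ℂ H)))
  filter_upwards [self_mem_nhdsWithin] with t ht
  exact (difference_quotient_bounds hρ (hRp t ht) ht).1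

/-- The squared matrix entries of `a` in the eigenbasis sum to `‖a (b j)‖²` along one index and to
`‖star a (b j)‖²` along the other. Hence `ha` is the hypothesis on rates in `f_le_flow`. -/
theorem f_le_entropyFlow (hρ : ρ.IsPositive) (htr : reTrace ρ = 1)
    (ha : ∀ v, ‖star a v‖ ^ 2 ≤ ‖a v‖ ^ 2 + ‖v‖ ^ 2) {d : ℕ}
    {b : OrthonormalBasis (Fin d) ℂ H} {p : Fin d → ℝ} (hp : Antitone p)
    (hb : ∀ i, ρ (b i) = (p i : ℂ) • b i)
    (hleak : ∀ i j, p j = 0 → p i * ‖⟪b j, a (b i)⟫_ℂ‖ ^ 2 = 0) :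
    f (reTrace (cfc Real.negMulLog ρ)) ≤ entropyFlow a b p := by
  rw [reTrace_of_eigenbasis (cfc_apply_eigenbasis hρ.isSelfAdjoint hb _)]
  refine f_le_flow (eigenvalue_nonneg hρ hb) hp ?_ (fun i j => sq_nonneg _) (fun j => ?_) hleak
  · rw [← htr, reTrace_of_eigenbasis hb]
  · have h1 : ∑ i, ‖⟪b j, a (b i)⟫_ℂ‖ ^ 2 = ‖star a (b j)‖ ^ 2 := by
      rw [← b.sum_sq_norm_inner_left]
      simp only [ContinuousLinearMap.star_eq_adjoint, ContinuousLinearMap.adjoint_inner_left]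
    have h2 := ha (b j)
    rw [b.norm_eq_one, one_pow] at h2
    rw [h1, b.sum_sq_norm_inner_right]
    exact h2

theorem exists_tendsto_difference_quotient (hρ : ρ.IsPositive) (htr : reTrace ρ = 1)
    (hRp : ∀ t, 0 < t → (R t).IsPositive)
    (hR : (fun t => R t - ρ - t • lindblad a ρ) =O[𝓝[>] 0] fun t => t ^ 2)
    (ha : ∀ v, ‖star a v‖ ^ 2 ≤ ‖a v‖ ^ 2 + ‖v‖ ^ 2) :
    ∃ D : EReal, Tendsto (fun t => (((reTrace (cfc Real.negMulLog (R t)) -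
        reTrace (cfc Real.negMulLog ρ)) / t : ℝ) : EReal)) (𝓝[>] 0) (𝓝 D) ∧
      ((f (reTrace (cfc Real.negMulLog ρ)) : ℝ) : EReal) ≤ D := by
  obtain ⟨b, p, hp, hb⟩ := exists_eigenbasis hρ.isSelfAdjoint
  by_cases hleak : ∀ i j, p j = 0 → p i * ‖⟪b j, a (b i)⟫_ℂ‖ ^ 2 = 0
  · refine ⟨(entropyFlow a b p : ℝ), ?_, EReal.coe_le_coe_iff.2 (f_le_entropyFlow hρ htr ha hp hb hleak)⟩
    exact (continuous_coe_real_ereal.tendsto _).comp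
      (tendsto_difference_quotient hρ hRp hR hb hleak)
  · push Not at hleak
    obtain ⟨i, j, hj, hij⟩ := hleak
    exact ⟨⊤, EReal.tendsto_coe_nhds_top_iff.2
      (tendsto_difference_quotient_atTop hρ hRp hR hb hj hij), le_top⟩

end Evolution

end FiniteDim

/-! ### The beamsplitter on `|n⟩ ⊗ |0⟩` -/

/-- The coefficient of `|i⟩ ⊗ |k⟩` in `exp (θ (a† b - a b†)) |i + k⟩ ⊗ |0⟩`. -/
def amplitude (θ : ℝ) (y : ℕ × ℕ) : ℝ :=
  (-1) ^ y.2 * Real.sqrt ((y.1 + y.2).choose y.2) * (Real.cos θ ^ y.1 * Real.sin θ ^ y.2)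

/-- The derivative of `amplitude`. -/
def amplitudeDeriv (θ : ℝ) (y : ℕ × ℕ) : ℝ :=
  (-1) ^ y.2 * Real.sqrt ((y.1 + y.2).choose y.2) *
    ((y.1 * Real.cos θ ^ (y.1 - 1) * -Real.sin θ) * Real.sin θ ^ y.2 +
      Real.cos θ ^ y.1 * (y.2 * Real.sin θ ^ (y.2 - 1) * Real.cos θ))

theorem hasDerivAt_amplitude (θ : ℝ) (y : ℕ × ℕ) :
    HasDerivAt (fun s => amplitude s y) (amplitudeDeriv θ y) θ :=
  (((Real.hasDerivAt_cos θ).pow y.1).mul ((Real.hasDerivAt_sin θ).pow y.2)).const_mul _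

theorem sqrt_mul_sqrt_choose (i k : ℕ) :
    Real.sqrt (i + 1) * Real.sqrt ((i + 1 + k).choose k) =
      Real.sqrt (k + 1) * Real.sqrt ((i + (k + 1)).choose (k + 1)) := by
  rw [← Real.sqrt_mul (by positivity), ← Real.sqrt_mul (by positivity)]
  congr 1
  have h := Nat.choose_succ_right_eq (i + (k + 1)) k
  have h1 : i + (k + 1) - k = i + 1 := by omega
  rw [h1] at h
  have h2 : i + 1 + k = i + (k + 1) := by omega
  rw [h2]
  have h3 : (((i + (k + 1)).choose (k + 1) : ℕ) : ℝ) * (k + 1) =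
      ((i + (k + 1)).choose k : ℕ) * (i + 1) := by exact_mod_cast h
  linarith

/-- The Schrödinger equation in coordinates, from `(i + 1) * choose (i + 1 + k) k = (k + 1) * choose
(i + k + 1) (k + 1)`. Where the truncated `k - 1` or `i - 1` is meaningless, the factor `√0` removes
the term. -/
theorem amplitudeDeriv_eq (θ : ℝ) (i k : ℕ) :
    amplitudeDeriv θ (i, k) = -(Real.sqrt (i + 1) * Real.sqrt k * amplitude θ (i + 1, k - 1) -
      Real.sqrt i * Real.sqrt (k + 1) * amplitude θ (i - 1, k + 1)) := by
  have h1 : (-1) ^ k * Real.sqrt ((i + k).choose k) *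
        (Real.cos θ ^ i * (k * Real.sin θ ^ (k - 1) * Real.cos θ)) =
      -(Real.sqrt (i + 1) * Real.sqrt k * amplitude θ (i + 1, k - 1)) := by
    rcases k with _ | k
    · simp
    · have h := sqrt_mul_sqrt_choose i k
      have hk : Real.sqrt ((k : ℝ) + 1) * Real.sqrt (k + 1) = k + 1 :=
        Real.mul_self_sqrt (by positivity)
      simp only [amplitude, Nat.add_sub_cancel, Nat.cast_add, Nat.cast_one]
      linear_combination (-1) ^ k * Real.sqrt (k + 1) * Real.cos θ ^ (i + 1) * Real.sin θ ^ k * h +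
        (-1) ^ k * Real.sqrt ((i + (k + 1)).choose (k + 1)) * Real.cos θ ^ (i + 1) *
          Real.sin θ ^ k * hk
  have h2 : (-1) ^ k * Real.sqrt ((i + k).choose k) *
        ((i * Real.cos θ ^ (i - 1) * -Real.sin θ) * Real.sin θ ^ k) =
      Real.sqrt i * Real.sqrt (k + 1) * amplitude θ (i - 1, k + 1) := by
    rcases i with _ | i
    · simp
    · have h := sqrt_mul_sqrt_choose i k
      have hi : Real.sqrt ((i : ℝ) + 1) * Real.sqrt (i + 1) = i + 1 :=
        Real.mul_self_sqrt (by positivity)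
      simp only [amplitude, Nat.add_sub_cancel, Nat.cast_add, Nat.cast_one]
      linear_combination
        (-1) ^ (k + 1) * Real.sqrt (i + 1) * Real.cos θ ^ i * Real.sin θ ^ (k + 1) * h +
        (-1) ^ k * Real.sqrt ((i + 1 + k).choose k) * Real.cos θ ^ i *
          Real.sin θ ^ (k + 1) * hi
  rw [amplitudeDeriv, mul_add]
  dsimp only
  rw [h1, h2]
  ring

/-- The vector `exp (θ (a† b - a b†)) |n⟩ ⊗ |0⟩`, in closed form. -/
def binomialVector (n : ℕ) (θ : ℝ) : ℓ²(ℕ × ℕ, ℂ) :=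
  ∑ y ∈ Finset.HasAntidiagonal.antidiagonal n, (amplitude θ y : ℂ) • ket y

theorem inner_ket_sum (n : ℕ) (c : ℕ × ℕ → ℂ) (x : ℕ × ℕ) :
    ⟪ket x, ∑ y ∈ Finset.HasAntidiagonal.antidiagonal n, c y • (ket y : ℓ²(ℕ × ℕ, ℂ))⟫_ℂ =
      if x.1 + x.2 = n then c x else 0 := by
  have h := orthonormal_iff_ite.1 (orthonormal_ket (ι := ℕ × ℕ))
  simp only [inner_sum, inner_smul_right, h, mul_ite, mul_one, mul_zero]
  rw [Finset.sum_ite_eq]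
  simp only [Finset.HasAntidiagonal.mem_antidiagonal]

theorem hasDerivAt_binomialVector (n : ℕ) (θ : ℝ) :
    HasDerivAt (binomialVector n)
      (∑ y ∈ Finset.HasAntidiagonal.antidiagonal n, (amplitudeDeriv θ y : ℂ) • (ket y : ℓ²(ℕ × ℕ, ℂ))) θ := by
  refine HasDerivAt.fun_sum fun y _ => ?_
  exact (hasDerivAt_amplitude θ y).ofReal_comp.smul_const (ket y)

theorem truncGenerator_binomialVector (n : ℕ) (θ : ℝ) :
    truncGenerator n (binomialVector n θ) =
      ∑ y ∈ Finset.HasAntidiagonal.antidiagonal n, (amplitudeDeriv θ y : ℂ) • (ket y : ℓ²(ℕ × ℕ, ℂ)) := by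
  refine eq_of_inner_ket fun x => ?_
  rw [inner_ket_sum]
  split_ifs with hx
  · obtain ⟨i, k⟩ := x
    have hs := truncGenerator_skew n
    rw [skewAdjoint.mem_iff, ContinuousLinearMap.star_eq_adjoint] at hs
    -- Skewness moves the generator onto the basis vector, where it has only two terms.
    have h1 : ⟪ket (i, k), truncGenerator n (binomialVector n θ)⟫_ℂ =
        -⟪truncGenerator n (ket (i, k)), binomialVector n θ⟫_ℂ := by
      rw [← ContinuousLinearMap.adjoint_inner_left, hs, neg_apply, inner_neg_left]
    have hx' : i + k = n := hx
    rw [h1, truncGenerator_ket (mem_lowPhotons.2 hx'.le), generator_single, map_sub]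
    simp only [toHilbert, Finsupp.linearCombination_single]
    rw [inner_sub_left, inner_smul_left, inner_smul_left, binomialVector, inner_ket_sum,
      inner_ket_sum, Complex.conj_ofReal, Complex.conj_ofReal, amplitudeDeriv_eq]
    have e1 : (((Real.sqrt (i + 1) * Real.sqrt k : ℝ) : ℂ) *
        if (i + 1, k - 1).1 + (i + 1, k - 1).2 = n then (amplitude θ (i + 1, k - 1) : ℂ) else 0) =
        ((Real.sqrt (i + 1) * Real.sqrt k * amplitude θ (i + 1, k - 1) : ℝ) : ℂ) := by
      rcases k with _ | k
      · simp
      · rw [if_pos (by simp only; omega)]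
        push_cast
        rfl
    have e2 : (((Real.sqrt i * Real.sqrt (k + 1) : ℝ) : ℂ) *
        if (i - 1, k + 1).1 + (i - 1, k + 1).2 = n then (amplitude θ (i - 1, k + 1) : ℂ) else 0) =
        ((Real.sqrt i * Real.sqrt (k + 1) * amplitude θ (i - 1, k + 1) : ℝ) : ℂ) := by
      rcases i with _ | i
      · simp
      · rw [if_pos (by simp only; omega)]
        push_cast
        rfl
    rw [e1, e2, ← Complex.ofReal_sub, ← Complex.ofReal_neg]
  · rw [binomialVector, map_sum, inner_sum]
    refine Finset.sum_eq_zero fun y hy => ?_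
    rw [map_smul, inner_smul_right, inner_truncGenerator]
    rw [Finset.HasAntidiagonal.mem_antidiagonal] at hy
    split_ifs
    · by_cases h0 : (generator (Finsupp.single y 1)) x = 0
      · rw [h0, mul_zero]
      · exact absurd (generator_ne_zero h0) (by omega)
    · rw [mul_zero]

theorem binomialVector_zero (n : ℕ) : binomialVector n 0 = ket (n, 0) := by
  rw [binomialVector, Finset.sum_eq_single (n, 0)]
  · simp [amplitude]
  · rintro ⟨i, k⟩ hy hne
    rw [Finset.HasAntidiagonal.mem_antidiagonal] at hy
    have hk : k ≠ 0 := by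
      rintro rfl
      apply hne
      simp at hy
      rw [hy]
    simp [amplitude, hk]
  · simp

/-- Both sides solve the linear equation `ψ' = G ψ` with value `|n, 0⟩` at `0`, where `G` is the
bounded generator on at most `n` photons; solutions are unique. -/
theorem expKet_eq_binomialVector (n : ℕ) (θ : ℝ) : expKet θ (n, 0) = binomialVector n θ := by
  have hx : ((n, 0) : ℕ × ℕ) ∈ lowPhotons n := mem_lowPhotons.2 (by simp)
  have h1 : ∀ s : ℝ, HasDerivAt
      (fun s : ℝ => NormedSpace.exp ((s : ℂ) • truncGenerator n) (ket (n, 0)))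
      (truncGenerator n (NormedSpace.exp ((s : ℂ) • truncGenerator n) (ket (n, 0)))) s := by
    intro s
    have h2 := (hasDerivAt_exp_smul_const' (truncGenerator n) (s : ℂ)).scomp s
      Complex.ofRealCLM.hasDerivAt
    rw [Complex.ofRealCLM_apply, Complex.ofReal_one, one_smul] at h2
    exact ((ContinuousLinearMap.apply ℂ (ℓ²(ℕ × ℕ, ℂ)) (ket (n, 0))).restrictScalars
      ℝ).hasFDerivAt.comp_hasDerivAt s h2
  have h3 := ODE_solution_unique_univ (v := fun _ => truncGenerator n) (s := fun _ => Set.univ)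
    (t₀ := 0) (fun _ => (truncGenerator n).lipschitz.lipschitzOnWith)
    (fun s => ⟨h1 s, Set.mem_univ _⟩)
    (fun s => ⟨(truncGenerator_binomialVector n s).symm ▸ hasDerivAt_binomialVector n s,
      Set.mem_univ _⟩)
    (by simp [binomialVector_zero])
  rw [expKet_eq hx]
  exact congrFun h3 θ

/-! ### The cut-off Fock space -/

/-- The inclusion of the span of `|0⟩, …, |d - 1⟩` into the Fock space. -/
def embed (d : ℕ) : EuclideanSpace ℂ (Fin d) →L[ℂ] ℓ²(ℕ, ℂ) :=
  ∑ i : Fin d, InnerProductSpace.rankOne ℂ (ket (i : ℕ)) (EuclideanSpace.basisFun (Fin d) ℂ i)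

theorem embed_apply (d : ℕ) (v : EuclideanSpace ℂ (Fin d)) :
    embed d v = ∑ i, v i • ket (i : ℕ) := by
  simp [embed, EuclideanSpace.inner_single_left]

theorem inner_ket_embed (d n : ℕ) (v : EuclideanSpace ℂ (Fin d)) :
    ⟪ket n, embed d v⟫_ℂ = if h : n < d then v ⟨n, h⟩ else 0 := by
  have ho := orthonormal_iff_ite.1 (orthonormal_ket (ι := ℕ))
  rw [embed_apply, inner_sum]
  simp only [inner_smul_right, ho, mul_ite, mul_one, mul_zero]
  split_ifs with h
  · rw [Finset.sum_eq_single ⟨n, h⟩]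
    · simp
    · intro i _ hi
      rw [if_neg]
      rintro rfl
      exact hi rfl
    · simp
  · refine Finset.sum_eq_zero fun i _ => if_neg ?_
    rintro rfl
    exact h i.2

theorem adjoint_embed_ket (d n : ℕ) :
    (embed d).adjoint (ket n) =
      if h : n < d then EuclideanSpace.basisFun (Fin d) ℂ ⟨n, h⟩ else 0 := by
  refine ext_inner_right ℂ fun v => ?_
  rw [ContinuousLinearMap.adjoint_inner_left, inner_ket_embed]
  split_ifs with h
  · simp [EuclideanSpace.inner_single_left]
  · simp

theorem embed_basisFun (d : ℕ) (i : Fin d) :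
    embed d (EuclideanSpace.basisFun (Fin d) ℂ i) = ket (i : ℕ) := by
  rw [embed_apply, Finset.sum_eq_single i]
  · simp
  · intro k _ hk
    simp [hk]
  · simp

theorem op_ext_basisFun {d : ℕ} {F : Type*} [NormedAddCommGroup F] [NormedSpace ℂ F]
    {S T : EuclideanSpace ℂ (Fin d) →L[ℂ] F}
    (h : ∀ i, S (EuclideanSpace.basisFun (Fin d) ℂ i) = T (EuclideanSpace.basisFun (Fin d) ℂ i)) :
    S = T := by
  refine ContinuousLinearMap.coe_injective
    ((EuclideanSpace.basisFun (Fin d) ℂ).toBasis.ext fun i => ?_)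
  simpa using h i

theorem adjoint_embed_comp_embed (d : ℕ) : (embed d).adjoint ∘L embed d = 1 := by
  refine op_ext_basisFun fun i => ?_
  rw [ContinuousLinearMap.comp_apply, embed_basisFun, adjoint_embed_ket, dif_pos i.2]
  rfl

/-- The operator on the Fock space with a given restriction to the span of `|0⟩, …, |d - 1⟩`. -/
def conjEmbed (d : ℕ) :
    (EuclideanSpace ℂ (Fin d) →L[ℂ] EuclideanSpace ℂ (Fin d)) →⋆ₙₐ[ℂ] (ℓ²(ℕ, ℂ) →L[ℂ] ℓ²(ℕ, ℂ)) where
  toFun A := embed d ∘L A ∘L (embed d).adjoint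
  map_smul' c A := by simp
  map_zero' := by simp
  map_add' A B := by ext; simp
  map_mul' A B := by
    have h : ∀ v, (embed d).adjoint (embed d v) = v := fun v =>
      DFunLike.congr_fun (adjoint_embed_comp_embed d) v
    ext x : 1
    simp only [ContinuousLinearMap.comp_apply, mul_apply_eq_comp, h]
  map_star' A := by
    simp only [ContinuousLinearMap.star_eq_adjoint, ContinuousLinearMap.adjoint_comp,
      ContinuousLinearMap.adjoint_adjoint]
    rfl

theorem conjEmbed_apply (d : ℕ) (A : EuclideanSpace ℂ (Fin d) →L[ℂ] EuclideanSpace ℂ (Fin d)) :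
    conjEmbed d A = embed d ∘L A ∘L (embed d).adjoint := rfl

theorem continuous_conjEmbed (d : ℕ) : Continuous (conjEmbed d) := by
  have : (conjEmbed d : _ → _) = fun A => embed d ∘L A ∘L (embed d).adjoint := rfl
  rw [this]
  fun_prop

theorem inner_ket_conjEmbed (d n : ℕ)
    (A : EuclideanSpace ℂ (Fin d) →L[ℂ] EuclideanSpace ℂ (Fin d)) :
    ⟪ket n, conjEmbed d A (ket n)⟫_ℂ = if h : n < d then
      ⟪EuclideanSpace.basisFun (Fin d) ℂ ⟨n, h⟩, A (EuclideanSpace.basisFun (Fin d) ℂ ⟨n, h⟩)⟫_ℂ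
      else 0 := by
  rw [conjEmbed_apply, ContinuousLinearMap.comp_apply, ContinuousLinearMap.comp_apply,
    ← ContinuousLinearMap.adjoint_inner_left, adjoint_embed_ket]
  split_ifs <;> simp

/-- The homomorphism need not be unital, as is the case for `conjEmbed`. Because `0 ln 0 = 0`, the
non-unital functional calculus applies and commutes with it. -/
theorem negMulLogOp_map {E F : Type} [NormedAddCommGroup E] [InnerProductSpace ℂ E]
    [CompleteSpace E] [NormedAddCommGroup F] [InnerProductSpace ℂ F] [CompleteSpace F]
    {φ : (E →L[ℂ] E) →⋆ₙₐ[ℂ] (F →L[ℂ] F)} (hφ : Continuous φ) {A : E →L[ℂ] E}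
    (hA : IsSelfAdjoint A) :
    negMulLogOp (φ A) = φ (negMulLogOp A) := by
  have hc : ∀ s, ContinuousOn Real.negMulLog s := fun s => Real.continuous_negMulLog.continuousOn
  have hA' : IsSelfAdjoint (φ A) := hA.map φ
  have h := NonUnitalStarAlgHomClass.map_cfcₙ φ Real.negMulLog A (hc _)
    Real.negMulLog_zero hφ hA hA'
  rw [cfcₙ_eq_cfc (hc _) Real.negMulLog_zero, cfcₙ_eq_cfc (hc _) Real.negMulLog_zero] at h
  exact h.symm

theorem negMulLogOp_conjEmbed {d : ℕ}
    {A : EuclideanSpace ℂ (Fin d) →L[ℂ] EuclideanSpace ℂ (Fin d)} (hA : IsSelfAdjoint A) :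
    negMulLogOp (conjEmbed d A) = conjEmbed d (cfc Real.negMulLog A) :=
  negMulLogOp_map (continuous_conjEmbed d) hA

theorem sum_dite_lt {M : Type*} [AddCommMonoid M] (d : ℕ) (F : Fin d → M) :
    ∑ n ∈ Finset.range d, (if h : n < d then F ⟨n, h⟩ else 0) = ∑ i, F i := by
  rw [← Fin.sum_univ_eq_sum_range (fun n => if h : n < d then F ⟨n, h⟩ else 0)]
  simp

theorem re_inner_cfc_negMulLog_nonneg {d : ℕ}
    {A : EuclideanSpace ℂ (Fin d) →L[ℂ] EuclideanSpace ℂ (Fin d)} (hA : A.IsPositive)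
    (htr : reTrace A = 1) (v : EuclideanSpace ℂ (Fin d)) :
    0 ≤ (⟪v, cfc Real.negMulLog A v⟫_ℂ).re := by
  obtain ⟨b, p, -, hb⟩ := exists_eigenbasis hA.isSelfAdjoint
  have hp := eigenvalue_nonneg hA hb
  rw [re_inner_apply_of_eigenbasis (cfc_apply_eigenbasis hA.isSelfAdjoint hb _)]
  refine Finset.sum_nonneg fun i _ => mul_nonneg (Real.negMulLog_nonneg (hp i) ?_) (sq_nonneg _)
  rw [← htr, reTrace_of_eigenbasis hb]
  exact Finset.single_le_sum (fun j _ => hp j) (Finset.mem_univ i)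

theorem vonNeumannEntropy_conjEmbed {d : ℕ}
    {A : EuclideanSpace ℂ (Fin d) →L[ℂ] EuclideanSpace ℂ (Fin d)} (hA : A.IsPositive)
    (htr : reTrace A = 1) :
    vonNeumannEntropy (conjEmbed d A) = ENNReal.ofReal (reTrace (cfc Real.negMulLog A)) ∧
      0 ≤ reTrace (cfc Real.negMulLog A) := by
  have h0 := re_inner_cfc_negMulLog_nonneg hA htr
  have h1 := reTrace_eq_sum (EuclideanSpace.basisFun (Fin d) ℂ) (cfc Real.negMulLog A)
  refine ⟨?_, h1 ▸ Finset.sum_nonneg fun i _ => h0 _⟩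
  rw [vonNeumannEntropy, negMulLogOp_conjEmbed hA.isSelfAdjoint, h1,
    ENNReal.ofReal_sum_of_nonneg fun i _ => h0 _, tsum_eq_sum (s := Finset.range d), ← sum_dite_lt]
  · refine Finset.sum_congr rfl fun n hn => ?_
    rw [inner_ket_conjEmbed, dif_pos (Finset.mem_range.1 hn), dif_pos (Finset.mem_range.1 hn)]
  · intro n hn
    rw [inner_ket_conjEmbed, dif_neg (by simpa using hn)]
    simp

theorem exists_conjEmbed {ρ : ℓ²(ℕ, ℂ) →L[ℂ] ℓ²(ℕ, ℂ)} (hρ : IsState ρ)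
    (hfin : HasFiniteSupport ρ) :
    ∃ (d : ℕ) (A : EuclideanSpace ℂ (Fin d) →L[ℂ] EuclideanSpace ℂ (Fin d)),
      A.IsPositive ∧ reTrace A = 1 ∧ ρ = conjEmbed d A := by
  obtain ⟨N, hN⟩ := hfin
  set A := (embed (N + 1)).adjoint ∘L ρ ∘L embed (N + 1) with hA
  have h1 : ∀ n, N < n → ρ (ket n) = 0 := by
    intro n hn
    -- A Fock state above the cut-off is orthogonal to the support, hence lies in the double
    -- complement of the kernel, which is the kernel itself since that is closed.
    have h2 : (ket n : ℓ²(ℕ, ℂ)) ∈ (LinearMap.ker ρ.toLinearMap)ᗮᗮ := by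
      refine Submodule.orthogonal_le hN ?_
      rw [Submodule.mem_orthogonal]
      intro u hu
      refine Submodule.span_induction ?_ (inner_zero_left _) ?_ ?_ hu
      · rintro _ ⟨m, hm, rfl⟩
        have hm : m ≤ N := hm
        rw [orthonormal_iff_ite.1 (orthonormal_ket (ι := ℕ)), if_neg (by omega)]
      · intro x y _ _ hx hy
        rw [inner_add_left, hx, hy, add_zero]
      · intro c x _ hx
        rw [inner_smul_left, hx, mul_zero]
    have h3 : IsClosed (LinearMap.ker ρ.toLinearMap : Set ℓ²(ℕ, ℂ)) := ρ.isClosed_ker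
    have h4 := Submodule.orthogonal_orthogonal_eq_closure (LinearMap.ker ρ.toLinearMap)
    rw [h4, IsClosed.submodule_topologicalClosure_eq h3] at h2
    exact h2
  set P := embed (N + 1) ∘L (embed (N + 1)).adjoint with hP
  have h2 : ρ ∘L P = ρ := by
    refine op_ext_ket fun n => ?_
    rw [hP, ContinuousLinearMap.comp_apply, ContinuousLinearMap.comp_apply, adjoint_embed_ket]
    split_ifs with h
    · rw [embed_basisFun]
    · rw [map_zero, map_zero, h1 n (by omega)]
  have h3 : P ∘L ρ = ρ := by
    have h4 := congrArg ContinuousLinearMap.adjoint h2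
    rwa [ContinuousLinearMap.adjoint_comp, hP, ContinuousLinearMap.adjoint_comp,
      ContinuousLinearMap.adjoint_adjoint, ← ContinuousLinearMap.star_eq_adjoint ρ,
      hρ.1.isSelfAdjoint.star_eq] at h4
  have h5 : ρ = conjEmbed (N + 1) A := by
    have : conjEmbed (N + 1) A = P ∘L ρ ∘L P := rfl
    rw [this, h2, h3]
  refine ⟨N + 1, A, hρ.1.adjoint_conj _, ?_, h5⟩
  have h6 := hρ.2
  rw [h5] at h6
  have h7 : HasSum (fun n => ⟪ket n, conjEmbed (N + 1) A (ket n)⟫_ℂ)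
      (∑ n ∈ Finset.range (N + 1), ⟪ket n, conjEmbed (N + 1) A (ket n)⟫_ℂ) :=
    hasSum_sum_of_ne_finset_zero fun n hn => by
      rw [inner_ket_conjEmbed, dif_neg (by simpa using hn)]
  have h8 := h6.unique h7
  simp only [inner_ket_conjEmbed] at h8
  rw [sum_dite_lt (N + 1) fun i => ⟪EuclideanSpace.basisFun (Fin (N + 1)) ℂ i,
    A (EuclideanSpace.basisFun (Fin (N + 1)) ℂ i)⟫_ℂ] at h8
  rw [reTrace_eq_sum (EuclideanSpace.basisFun (Fin (N + 1)) ℂ), ← Complex.re_sum, ← h8,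
    Complex.one_re]

/-! ### Lindblad evolutions in Kraus form -/

section KrausForm

variable {H : Type*} [NormedAddCommGroup H] [InnerProductSpace ℂ H] [FiniteDimensional ℂ H]
  [CompleteSpace H]

theorem reTrace_sum {ι : Type*} (s : Finset ι) (X : ι → H →L[ℂ] H) :
    reTrace (∑ q ∈ s, X q) = ∑ q ∈ s, reTrace (X q) := by
  classical
  induction s using Finset.induction_on with
  | empty => simp [reTrace]
  | insert q s hq ih => rw [Finset.sum_insert hq, Finset.sum_insert hq, reTrace_add, ih]

/-- The operator `∑ xᵐ P m`, for projections `P m` this is `x` to the power of `∑ m P m`. -/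
def powSum {d : ℕ} (P : Fin d → H →L[ℂ] H) (x : ℝ) : H →L[ℂ] H := ∑ m : Fin d, x ^ (m : ℕ) • P m

theorem powSum_eq {d : ℕ} (P : Fin d → H →L[ℂ] H) (x : ℝ) :
    powSum P x = ∑ m : Fin d, ((x ^ (m : ℕ) : ℝ) : ℂ) • P m := rfl

/-- The operator `∑ m P m`. -/
def numberSum {d : ℕ} (P : Fin d → H →L[ℂ] H) : H →L[ℂ] H := ∑ m : Fin d, ((m : ℕ) : ℝ) • P m

theorem numberSum_eq {d : ℕ} (P : Fin d → H →L[ℂ] H) :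
    numberSum P = ∑ m : Fin d, (((m : ℕ) : ℝ) : ℂ) • P m := rfl

theorem analyticAt_powSum_exp {d : ℕ} (P : Fin d → H →L[ℂ] H) :
    AnalyticAt ℝ (fun t : ℝ => powSum P (Real.exp (-t / 2))) 0 := by
  simp only [powSum]
  fun_prop

theorem hasDerivAt_powSum_exp {d : ℕ} (P : Fin d → H →L[ℂ] H) :
    HasDerivAt (fun t : ℝ => powSum P (Real.exp (-t / 2))) (-(2⁻¹ : ℝ) • numberSum P) 0 := by
  simp only [powSum, numberSum, Finset.smul_sum]
  refine HasDerivAt.fun_sum fun m _ => ?_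
  have h1 : HasDerivAt (fun t : ℝ => Real.exp (-t / 2)) (-2⁻¹) 0 := by
    have := ((hasDerivAt_neg (0 : ℝ)).div_const 2).exp
    simpa [neg_div] using this
  refine ((h1.pow (m : ℕ)).smul_const (P m)).congr_deriv ?_
  rw [smul_smul]
  congr 1
  simp [mul_comm]

/-- The operator `∑ cᵍ D L_q A L_q† D`. -/
def krausSum (D : H →L[ℂ] H) (L : ℕ → H →L[ℂ] H) (A : H →L[ℂ] H) (n : ℕ) (c : ℝ) : H →L[ℂ] H :=
  ∑ q ∈ Finset.range n, c ^ q • (D * (L q * A * star (L q)) * D)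

theorem isPositive_krausSum {D : H →L[ℂ] H} (hD : star D = D) (L : ℕ → H →L[ℂ] H)
    {A : H →L[ℂ] H} (hA : A.IsPositive) (n : ℕ) {c : ℝ} (hc : 0 ≤ c) :
    (krausSum D L A n c).IsPositive := by
  rw [← ContinuousLinearMap.nonneg_iff_isPositive]
  refine Finset.sum_nonneg fun q _ => smul_nonneg (pow_nonneg hc q)
    ((ContinuousLinearMap.nonneg_iff_isPositive _).2 ?_)
  have h := (hA.conj_adjoint (L q)).conj_adjoint D
  rw [← ContinuousLinearMap.star_eq_adjoint, ← ContinuousLinearMap.star_eq_adjoint, hD] at h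
  exact h

theorem reTrace_krausSum (D : H →L[ℂ] H) (L : ℕ → H →L[ℂ] H) (A : H →L[ℂ] H) (n : ℕ) (c : ℝ) :
    reTrace (krausSum D L A n c) = reTrace ((∑ q ∈ Finset.range n,
      ((c ^ q : ℝ) : ℂ) • (star (L q) * (D * D) * L q)) * A) := by
  have h : ∀ q, reTrace (D * (L q * A * star (L q)) * D) =
      reTrace ((star (L q) * (D * D) * L q) * A) := by
    intro q
    rw [reTrace_mul_comm, ← mul_assoc, ← mul_assoc, reTrace_mul_comm, ← mul_assoc, ← mul_assoc]
  rw [krausSum, Finset.sum_mul, reTrace_sum, reTrace_sum]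
  refine Finset.sum_congr rfl fun q _ => ?_
  rw [smul_mul_assoc, Complex.coe_smul, reTrace_smul, reTrace_smul, h]

variable {D : ℝ → H →L[ℂ] H} {N : H →L[ℂ] H}

/-- The Kraus operators contain `√(1 - exp (-t))`, not differentiable at `0`. Only its squared
powers enter the sum, and these are analytic. -/
theorem analyticAt_krausSum (hD : AnalyticAt ℝ D 0) (L : ℕ → H →L[ℂ] H) (A : H →L[ℂ] H) (n : ℕ) :
    AnalyticAt ℝ (fun t => krausSum (D t) L A n (1 - Real.exp (-t))) 0 := by
  refine Finset.analyticAt_fun_sum _ fun q _ => ?_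
  have h : AnalyticAt ℝ (fun t : ℝ => (1 - Real.exp (-t)) ^ q) 0 := by fun_prop
  exact h.smul ((hD.mul analyticAt_const).mul hD)

theorem krausSum_zero {L : ℕ → H →L[ℂ] H} (hL : L 0 = 1) (A : H →L[ℂ] H) (n : ℕ) :
    krausSum 1 L A (n + 1) 0 = A := by
  rw [krausSum, Finset.sum_eq_single 0]
  · simp [hL]
  · intro q _ hq
    simp [hq]
  · simp

/-- The term `q = 0` gives the anticommutator with `N`, the term `q = 1` the jump, and `(1 - exp
(-t)) ^ q` kills the others to first order. The range `n + 2` ensures that both terms are present.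
-/
theorem hasDerivAt_krausSum (h0 : D 0 = 1) (hD : HasDerivAt D (-(2⁻¹ : ℝ) • N) 0)
    {L : ℕ → H →L[ℂ] H} (hL : L 0 = 1) (hN : star (L 1) * L 1 = N) (A : H →L[ℂ] H) (n : ℕ) :
    HasDerivAt (fun t => krausSum (D t) L A (n + 2) (1 - Real.exp (-t))) (lindblad (L 1) A) 0 := by
  have h1 : HasDerivAt (fun t : ℝ => 1 - Real.exp (-t)) 1 0 := by
    have := ((hasDerivAt_neg (0 : ℝ)).exp).const_sub 1
    simpa using this
  have h3 : HasDerivAt (fun t => krausSum (D t) L A (n + 2) (1 - Real.exp (-t)))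
      (∑ q ∈ Finset.range (n + 2), _) 0 :=
    HasDerivAt.fun_sum fun q _ => (h1.pow q).smul
      ((hD.mul_const (L q * A * star (L q))).mul hD)
  refine h3.congr_deriv ?_
  simp only [neg_zero, Real.exp_zero, sub_self, mul_one, Pi.pow_apply, h0, one_mul]
  rw [Finset.sum_range_succ', Finset.sum_range_succ', Finset.sum_eq_zero fun q _ => ?_]
  · simp only [lindblad, hN, hL, zero_add, pow_one, pow_zero, zero_smul, one_smul, Nat.cast_one,
      Nat.cast_zero, one_mul, mul_one, star_one, zero_mul, tsub_self, smul_mul_assoc,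
      mul_smul_comm, neg_mul, mul_neg, neg_smul, smul_add, add_zero]
    abel
  · simp

end KrausForm

/-! ### The attenuator on the cut-off Fock space -/

/-- The matrix of the loss of `q` photons. -/
def lossMatrix (d q : ℕ) : Matrix (Fin d) (Fin d) ℂ :=
  Matrix.of fun m n => if (m : ℕ) + q = n then
    (((-1) ^ q * Real.sqrt ((n : ℕ).choose q) : ℝ) : ℂ) else 0

/-- The loss of `q` photons. -/
def loss (d q : ℕ) : EuclideanSpace ℂ (Fin d) →L[ℂ] EuclideanSpace ℂ (Fin d) :=
  Matrix.toEuclideanCLM (n := Fin d) (𝕜 := ℂ) (lossMatrix d q)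

/-- The diagonal operator `|n⟩ ↦ c n |n⟩`. -/
def diagOp {d : ℕ} (c : Fin d → ℂ) : EuclideanSpace ℂ (Fin d) →L[ℂ] EuclideanSpace ℂ (Fin d) :=
  Matrix.toEuclideanCLM (n := Fin d) (𝕜 := ℂ) (Matrix.diagonal c)

/-- The operator `|n⟩ ↦ xⁿ |n⟩`. -/
def powOp (d : ℕ) (x : ℝ) : EuclideanSpace ℂ (Fin d) →L[ℂ] EuclideanSpace ℂ (Fin d) :=
  diagOp fun m => ((x ^ (m : ℕ) : ℝ) : ℂ)

theorem star_powOp (d : ℕ) (x : ℝ) : star (powOp d x) = powOp d x := by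
  rw [powOp, diagOp, ← map_star, Matrix.star_eq_conjTranspose, Matrix.diagonal_conjTranspose]
  congr 2
  funext m
  simp [Pi.star_apply]

theorem powOp_mul_powOp (d : ℕ) (x : ℝ) : powOp d x * powOp d x = powOp d (x ^ 2) := by
  rw [powOp, powOp, diagOp, diagOp, ← map_mul, Matrix.diagonal_mul_diagonal]
  congr 2
  funext m
  push_cast
  ring

theorem powOp_one (d : ℕ) : powOp d 1 = 1 := by
  simp [powOp, diagOp]

theorem re_inner_diagOp {d : ℕ} (c : Fin d → ℝ) (v : EuclideanSpace ℂ (Fin d)) :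
    (⟪v, diagOp (fun m => (c m : ℂ)) v⟫_ℂ).re = ∑ m, c m * ‖v m‖ ^ 2 := by
  have hb : ∀ m, diagOp (fun m => (c m : ℂ)) (EuclideanSpace.basisFun (Fin d) ℂ m) =
      (c m : ℂ) • EuclideanSpace.basisFun (Fin d) ℂ m := by
    intro m
    ext k
    rw [diagOp, Matrix.ofLp_toEuclideanCLM, Matrix.mulVec_diagonal]
    rcases eq_or_ne k m with rfl | h
    · simp
    · simp [h]
  rw [re_inner_apply_of_eigenbasis hb]
  simp [EuclideanSpace.inner_single_left]

/-- `star (loss q) * xⁿ * loss q` is diagonal. -/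
theorem star_loss_mul_powOp_mul_loss (d q : ℕ) (x : ℝ) :
    star (loss d q) * powOp d x * loss d q =
      diagOp fun n => (((n : ℕ).choose q * x ^ ((n : ℕ) - q) : ℝ) : ℂ) := by
  rw [loss, powOp, diagOp, diagOp, ← map_star, ← map_mul, ← map_mul]
  congr 1
  ext n k
  rw [Matrix.star_eq_conjTranspose, Matrix.mul_assoc, Matrix.mul_apply]
  simp only [Matrix.diagonal_mul, Matrix.conjTranspose_apply, lossMatrix, Matrix.of_apply]
  rcases eq_or_ne n k with rfl | hnk
  · rw [Matrix.diagonal_apply_eq]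
    by_cases hq : q ≤ n
    · have hlt : (n : ℕ) - q < d := lt_of_le_of_lt (Nat.sub_le _ _) n.2
      rw [Finset.sum_eq_single ⟨(n : ℕ) - q, hlt⟩]
      · have h1 : (n : ℕ) - q + q = n := Nat.sub_add_cancel hq
        simp only [h1, if_true]
        rw [Complex.star_def, Complex.conj_ofReal, ← Complex.ofReal_mul, ← Complex.ofReal_mul]
        congr 1
        have h2 : Real.sqrt ((n : ℕ).choose q) * Real.sqrt ((n : ℕ).choose q) = (n : ℕ).choose q :=
          Real.mul_self_sqrt (Nat.cast_nonneg _)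
        have h3 : ((-1 : ℝ) ^ q) * (-1) ^ q = 1 := by
          rw [← mul_pow]
          norm_num
        calc _ = (((-1 : ℝ) ^ q) * (-1) ^ q) * (Real.sqrt ((n : ℕ).choose q) *
              Real.sqrt ((n : ℕ).choose q)) * x ^ ((n : ℕ) - q) := by ring
          _ = _ := by rw [h2, h3, one_mul]
      · intro m _ hm
        rw [if_neg]
        · simp
        · intro h
          apply hm
          ext
          simp only
          omega
      · simp
    · rw [Nat.choose_eq_zero_of_lt (by omega), Nat.cast_zero, zero_mul, Complex.ofReal_zero]
      refine Finset.sum_eq_zero fun m _ => ?_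
      rw [if_neg (by omega)]
      simp
  · rw [Matrix.diagonal_apply_ne _ hnk]
    refine Finset.sum_eq_zero fun m _ => ?_
    have hnk' : (n : ℕ) ≠ k := fun h => hnk (Fin.ext h)
    by_cases h : (m : ℕ) + q = n
    · rw [if_neg (show ¬ (m : ℕ) + q = k by omega), mul_zero, mul_zero]
    · rw [if_neg h, star_zero, zero_mul]

theorem loss_one_mul_star (d : ℕ) : loss d 1 * star (loss d 1) =
    diagOp fun m => (((if (m : ℕ) + 1 < d then (m : ℕ) + 1 else 0 : ℝ)) : ℂ) := by
  rw [loss, diagOp, ← map_star, ← map_mul]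
  congr 1
  ext m k
  rw [Matrix.star_eq_conjTranspose, Matrix.mul_apply]
  simp only [Matrix.conjTranspose_apply, lossMatrix, Matrix.of_apply]
  rcases eq_or_ne m k with rfl | hmk
  · rw [Matrix.diagonal_apply_eq]
    split_ifs with h
    · rw [Finset.sum_eq_single ⟨(m : ℕ) + 1, h⟩]
      · simp only [if_true]
        rw [Complex.star_def, Complex.conj_ofReal, ← Complex.ofReal_mul]
        congr 1
        have h2 := Real.mul_self_sqrt (show (0 : ℝ) ≤ (m : ℕ) + 1 by positivity)
        simp only [Nat.choose_one_right, Nat.cast_add, Nat.cast_one]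
        linarith
      · intro n _ hn
        rw [if_neg, zero_mul]
        intro h'
        exact hn (Fin.ext h'.symm)
      · simp
    · rw [Complex.ofReal_zero]
      refine Finset.sum_eq_zero fun n _ => ?_
      rw [if_neg (by omega), zero_mul]
  · rw [Matrix.diagonal_apply_ne _ hmk]
    refine Finset.sum_eq_zero fun n _ => ?_
    have hmk' : (m : ℕ) ≠ k := fun h => hmk (Fin.ext h)
    by_cases h : (m : ℕ) + 1 = n
    · rw [if_neg (show ¬ (k : ℕ) + 1 = n by omega), star_zero, mul_zero]
    · rw [if_neg h, zero_mul]

/-- The number operator. -/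
def numberOp (d : ℕ) : EuclideanSpace ℂ (Fin d) →L[ℂ] EuclideanSpace ℂ (Fin d) :=
  diagOp fun n => (((n : ℕ) : ℝ) : ℂ)

theorem star_loss_one_mul (d : ℕ) : star (loss d 1) * loss d 1 = numberOp d := by
  have h := star_loss_mul_powOp_mul_loss d 1 1
  rw [powOp_one, mul_one] at h
  rw [h, numberOp]
  simp

/-- On the full Fock space this is an equality, the commutation relation. The cut-off changes only
the top level, where `a a†` becomes `0`, so the inequality persists. -/
theorem norm_star_loss_one_sq_le (d : ℕ) (v : EuclideanSpace ℂ (Fin d)) :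
    ‖star (loss d 1) v‖ ^ 2 ≤ ‖loss d 1 v‖ ^ 2 + ‖v‖ ^ 2 := by
  have h1 : ‖loss d 1 v‖ ^ 2 = ∑ m : Fin d, ((m : ℕ) : ℝ) * ‖v m‖ ^ 2 := by
    rw [← re_inner_diagOp, ← numberOp, ← star_loss_one_mul, mul_apply_eq_comp,
      ContinuousLinearMap.star_eq_adjoint, ContinuousLinearMap.adjoint_inner_right,
      inner_self_eq_norm_sq_to_K]
    norm_cast
  have h2 : ‖star (loss d 1) v‖ ^ 2 =
      ∑ m : Fin d, (if (m : ℕ) + 1 < d then (m : ℕ) + 1 else 0 : ℝ) * ‖v m‖ ^ 2 := by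
    rw [← re_inner_diagOp, ← loss_one_mul_star, mul_apply_eq_comp,
      ← ContinuousLinearMap.adjoint_inner_left, ← ContinuousLinearMap.star_eq_adjoint,
      inner_self_eq_norm_sq_to_K]
    norm_cast
  rw [h1, h2, EuclideanSpace.norm_sq_eq, ← Finset.sum_add_distrib]
  refine Finset.sum_le_sum fun m _ => ?_
  have h3 : (if (m : ℕ) + 1 < d then (m : ℕ) + 1 else 0 : ℝ) ≤ (m : ℕ) + 1 := by
    split_ifs
    · exact le_rfl
    · positivity
  have := mul_le_mul_of_nonneg_right h3 (sq_nonneg ‖v m‖)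
  linarith

/-- The attenuator of transmissivity `exp (-t)` on the cut-off Fock space. -/
def evolution {d : ℕ} (A : EuclideanSpace ℂ (Fin d) →L[ℂ] EuclideanSpace ℂ (Fin d)) (t : ℝ) :
    EuclideanSpace ℂ (Fin d) →L[ℂ] EuclideanSpace ℂ (Fin d) :=
  krausSum (powOp d (Real.exp (-t / 2))) (loss d) A (d + 2) (1 - Real.exp (-t))

theorem isPositive_evolution {d : ℕ}
    {A : EuclideanSpace ℂ (Fin d) →L[ℂ] EuclideanSpace ℂ (Fin d)} (hA : A.IsPositive) {t : ℝ}
    (ht : 0 ≤ t) : (evolution A t).IsPositive := by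
  refine isPositive_krausSum (star_powOp d _) (loss d) hA _ ?_
  rw [sub_nonneg, Real.exp_le_one_iff]
  linarith

/-- Completeness of the Kraus operators: on `|n⟩` it is the binomial expansion of `((1 - x) + x) ^
n`. It makes the evolution trace preserving. -/
theorem sum_star_loss_mul_powOp_mul_loss (d : ℕ) (x : ℝ) :
    ∑ q ∈ Finset.range (d + 2), (((1 - x) ^ q : ℝ) : ℂ) •
      (star (loss d q) * powOp d x * loss d q) = 1 := by
  have h1 : ∀ n : Fin d, ∑ q ∈ Finset.range (d + 2), (1 - x) ^ q *
      ((n : ℕ).choose q * x ^ ((n : ℕ) - q)) = 1 := by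
    intro n
    have h2 := add_pow (1 - x) x (n : ℕ)
    rw [sub_add_cancel, one_pow] at h2
    refine Eq.trans ?_ h2.symm
    symm
    refine (Finset.sum_congr rfl fun q _ => ?_).trans
      (Finset.sum_subset (Finset.range_subset_range.2 (by omega)) fun q _ hq => ?_)
    · ring
    · rw [Finset.mem_range, not_lt] at hq
      rw [Nat.choose_eq_zero_of_lt (by omega)]
      simp
  simp only [star_loss_mul_powOp_mul_loss]
  refine op_ext_basisFun fun n => ?_
  ext k
  rw [sum_apply]
  simp only [smul_apply, diagOp]
  rw [WithLp.ofLp_sum, Finset.sum_apply]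
  simp only [WithLp.ofLp_smul, Pi.smul_apply, Matrix.ofLp_toEuclideanCLM, Matrix.mulVec_diagonal]
  rcases eq_or_ne k n with rfl | h
  · have h2 := congrArg (fun x : ℝ => (x : ℂ)) (h1 k)
    simp only [Complex.ofReal_sum] at h2
    simpa using h2
  · simp [h]

theorem reTrace_evolution {d : ℕ} (A : EuclideanSpace ℂ (Fin d) →L[ℂ] EuclideanSpace ℂ (Fin d))
    (t : ℝ) : reTrace (evolution A t) = reTrace A := by
  have hx : powOp d (Real.exp (-t / 2)) * powOp d (Real.exp (-t / 2)) = powOp d (Real.exp (-t)) := by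
    rw [powOp_mul_powOp, ← Real.exp_nat_mul]
    congr 2
    push_cast
    ring
  rw [evolution, reTrace_krausSum, hx, sum_star_loss_mul_powOp_mul_loss, one_mul]

theorem isBigO_sq_of_analyticAt {E : Type*} [NormedAddCommGroup E] [NormedSpace ℝ E] {F : ℝ → E}
    {F' : E} (hF : AnalyticAt ℝ F 0) (hd : HasDerivAt F F' 0) :
    (fun t => F t - F 0 - t • F') =O[𝓝 0] fun t => t ^ 2 := by
  obtain ⟨p, hp⟩ := hF
  have h := hp.isBigO_sub_partialSum_pow 2
  have h1 : p 1 (fun _ => 1) = F' := hp.hasDerivAt.unique hd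
  have h2 : ∀ y, p.partialSum 2 y = F 0 + y • F' := by
    intro y
    rw [FormalMultilinearSeries.partialSum, Finset.sum_range_succ, Finset.sum_range_one,
      hp.coeff_zero, ← h1]
    congr 1
    simp
  have h3 : (fun y : ℝ => ‖y‖ ^ 2) = fun y : ℝ => y ^ 2 := by
    funext y
    rw [Real.norm_eq_abs, sq_abs]
  simp only [zero_add, h2, h3] at h
  exact h.congr_left fun t => by abel

/-- The spectral form reduces analyticity and the derivative at `t = 0` to scalar powers of `exp (-t
/ 2)`. -/
theorem powOp_eq_powSum (d : ℕ) (x : ℝ) :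
    powOp d x = powSum (fun m : Fin d => diagOp (Pi.single m (1 : ℂ))) x := by
  rw [powSum_eq]
  refine op_ext_basisFun fun n => ?_
  ext k
  rw [sum_apply, WithLp.ofLp_sum, Finset.sum_apply]
  simp only [smul_apply, powOp, diagOp, WithLp.ofLp_smul, Pi.smul_apply,
    Matrix.ofLp_toEuclideanCLM, Matrix.mulVec_diagonal]
  rw [Finset.sum_eq_single k]
  · simp
  · intro m _ hm
    simp [hm.symm]
  · simp

theorem numberOp_eq_numberSum (d : ℕ) :
    numberOp d = numberSum (fun m : Fin d => diagOp (Pi.single m (1 : ℂ))) := by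
  rw [numberSum_eq]
  refine op_ext_basisFun fun n => ?_
  ext k
  rw [sum_apply, WithLp.ofLp_sum, Finset.sum_apply]
  simp only [smul_apply, numberOp, diagOp, WithLp.ofLp_smul, Pi.smul_apply,
    Matrix.ofLp_toEuclideanCLM, Matrix.mulVec_diagonal]
  rw [Finset.sum_eq_single k]
  · simp
  · intro m _ hm
    simp [hm.symm]
  · simp

theorem loss_zero (d : ℕ) : loss d 0 = 1 := by
  rw [loss, ← map_one (Matrix.toEuclideanCLM (n := Fin d) (𝕜 := ℂ))]
  congr 1
  ext m n
  simp [lossMatrix, Matrix.one_apply, Fin.ext_iff]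

theorem loss_eq_zero {d q : ℕ} (h : d ≤ q) : loss d q = 0 := by
  rw [loss, ← map_zero (Matrix.toEuclideanCLM (n := Fin d) (𝕜 := ℂ))]
  congr 1
  ext m n
  have : ¬ (m : ℕ) + q = n := by omega
  simp [lossMatrix, this]

theorem evolution_zero {d : ℕ} (A : EuclideanSpace ℂ (Fin d) →L[ℂ] EuclideanSpace ℂ (Fin d)) :
    evolution A 0 = A := by
  rw [evolution, neg_zero, zero_div, Real.exp_zero, sub_self, powOp_one]
  exact krausSum_zero (loss_zero d) A _

theorem isBigO_evolution {d : ℕ} (A : EuclideanSpace ℂ (Fin d) →L[ℂ] EuclideanSpace ℂ (Fin d)) :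
    (fun t : ℝ => evolution A t - A - (t : ℂ) • lindblad (loss d 1) A) =O[𝓝[>] 0]
      fun t => t ^ 2 := by
  have hD : (fun t : ℝ => powOp d (Real.exp (-t / 2))) = fun t : ℝ =>
      powSum (fun m : Fin d => diagOp (Pi.single m (1 : ℂ))) (Real.exp (-t / 2)) :=
    funext fun t => powOp_eq_powSum d _
  have h0 : (fun t : ℝ => powOp d (Real.exp (-t / 2))) 0 = 1 := by simp [powOp_one]
  have h1 := analyticAt_powSum_exp fun m : Fin d => diagOp (Pi.single m (1 : ℂ))
  have h2 := hasDerivAt_powSum_exp fun m : Fin d => diagOp (Pi.single m (1 : ℂ))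
  rw [← hD] at h1 h2
  rw [← numberOp_eq_numberSum] at h2
  have h3 := isBigO_sq_of_analyticAt (analyticAt_krausSum h1 (loss d) A (d + 2))
    (hasDerivAt_krausSum h0 h2 (loss_zero d) (star_loss_one_mul d) A d)
  have h4 : krausSum (powOp d (Real.exp (-0 / 2))) (loss d) A (d + 2) (1 - Real.exp (-0)) = A :=
    evolution_zero A
  rw [h4] at h3
  exact h3.mono nhdsWithin_le_nhds

/-! ### The Kraus operators of the attenuator -/

theorem adjoint_tensorKet_apply (q : ℕ) (x : ℕ) (u : ℓ²(ℕ × ℕ, ℂ)) :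
    ⟪ket x, (tensorKet q).adjoint u⟫_ℂ = ⟪ket (x, q), u⟫_ℂ := by
  rw [ContinuousLinearMap.adjoint_inner_right]
  congr 1
  exact isometryOf_ket (orthonormal_ket_right q) x

theorem inner_ket_adjoint_tensorKet_beamsplitter (lam : ℝ) (q x n : ℕ) :
    ⟪ket x, (tensorKet q).adjoint (beamsplitter lam (tensorKet 0 (ket n)))⟫_ℂ =
      if x + q = n then (amplitude (Real.arccos (Real.sqrt lam)) (x, q) : ℂ) else 0 := by
  have h1 : tensorKet 0 (ket n) = (ket (n, 0) : ℓ²(ℕ × ℕ, ℂ)) :=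
    isometryOf_ket (orthonormal_ket_right 0) n
  have h2 : beamsplitter lam (ket (n, 0)) = expKet (Real.arccos (Real.sqrt lam)) (n, 0) :=
    isometryOf_ket (orthonormal_expKet _) (n, 0)
  rw [adjoint_tensorKet_apply, h1, h2, expKet_eq_binomialVector, binomialVector, inner_ket_sum]

/-- The Kraus operators of the attenuator on the cut-off Fock space. -/
def kraus (d : ℕ) (t : ℝ) (q : ℕ) : EuclideanSpace ℂ (Fin d) →L[ℂ] EuclideanSpace ℂ (Fin d) :=
  ((Real.sqrt (1 - Real.exp (-t)) ^ q : ℝ) : ℂ) • (powOp d (Real.exp (-t / 2)) * loss d q)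

theorem amplitude_arccos {t : ℝ} (ht : 0 ≤ t) (x q : ℕ) :
    amplitude (Real.arccos (Real.sqrt (Real.exp (-t)))) (x, q) =
      Real.sqrt (1 - Real.exp (-t)) ^ q * (Real.exp (-t / 2) ^ x *
        ((-1) ^ q * Real.sqrt ((x + q).choose q))) := by
  have h0 : Real.sqrt (Real.exp (-t)) = Real.exp (-t / 2) := by
    rw [Real.exp_half]
  have h1 : Real.sqrt (Real.exp (-t)) ≤ 1 := by
    rw [h0, Real.exp_le_one_iff]
    linarith
  rw [amplitude, Real.cos_arccos (by linarith [Real.sqrt_nonneg (Real.exp (-t))]) h1,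
    Real.sin_arccos, Real.sq_sqrt (Real.exp_pos _).le, h0]
  ring

/-- Detecting `q` photons in the mode `B` leaves `|n⟩` as a multiple of `|n - q⟩`, so the cut-off
space is preserved. The amplitude factors into the loss matrix, `cos θ = exp (-t / 2)` to the power
of the remaining photons, and `sin θ ^ q`. -/
theorem adjoint_tensorKet_comp_beamsplitter {t : ℝ} (ht : 0 ≤ t) (d q : ℕ) :
    (tensorKet q).adjoint ∘L beamsplitter (Real.exp (-t)) ∘L tensorKet 0 ∘L embed d =
      embed d ∘L kraus d t q := by
  refine op_ext_basisFun fun n => eq_of_inner_ket fun x => ?_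
  simp only [ContinuousLinearMap.comp_apply]
  rw [embed_basisFun, inner_ket_adjoint_tensorKet_beamsplitter, inner_ket_embed,
    amplitude_arccos ht]
  by_cases hx : x < d
  · rw [dif_pos hx, kraus, smul_apply, WithLp.ofLp_smul, Pi.smul_apply, mul_apply_eq_comp, powOp,
      diagOp, Matrix.ofLp_toEuclideanCLM, Matrix.mulVec_diagonal, loss, Matrix.ofLp_toEuclideanCLM]
    simp only [EuclideanSpace.basisFun_apply, PiLp.ofLp_single, Matrix.mulVec_single_one,
      Matrix.col_apply, lossMatrix, Matrix.of_apply]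
    by_cases h : x + q = n
    · rw [if_pos h, if_pos h, h]
      simp
    · rw [if_neg h, if_neg h]
      simp
  · rw [dif_neg hx, if_neg (by omega)]

theorem kraus_conj_eq {d : ℕ} (A : EuclideanSpace ℂ (Fin d) →L[ℂ] EuclideanSpace ℂ (Fin d))
    {t : ℝ} (ht : 0 ≤ t) (q : ℕ) :
    kraus d t q * A * star (kraus d t q) = (((1 - Real.exp (-t)) ^ q : ℝ) : ℂ) •
      (powOp d (Real.exp (-t / 2)) * (loss d q * A * star (loss d q)) *
        powOp d (Real.exp (-t / 2))) := by
  have h0 : 0 ≤ 1 - Real.exp (-t) := by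
    rw [sub_nonneg, Real.exp_le_one_iff]
    linarith
  rw [kraus, star_smul, star_mul, star_powOp, Complex.star_def, Complex.conj_ofReal]
  simp only [smul_mul_assoc, mul_smul_comm, smul_smul]
  rw [← Complex.ofReal_mul, ← mul_pow, Real.mul_self_sqrt h0]
  simp only [mul_assoc]

theorem attenuator_conjEmbed {d : ℕ}
    (A : EuclideanSpace ℂ (Fin d) →L[ℂ] EuclideanSpace ℂ (Fin d)) {t : ℝ} (ht : 0 ≤ t) :
    attenuator (Real.exp (-t)) (conjEmbed d A) = conjEmbed d (evolution A t) := by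
  have h1 : ∀ q, (tensorKet q).adjoint ∘L (beamsplitter (Real.exp (-t)) ∘L
      tensorVacuum (conjEmbed d A) ∘L (beamsplitter (Real.exp (-t))).adjoint) ∘L tensorKet q =
      conjEmbed d (kraus d t q * A * star (kraus d t q)) := by
    intro q
    have h2 := adjoint_tensorKet_comp_beamsplitter ht d q
    have h3 := congrArg ContinuousLinearMap.adjoint h2
    simp only [ContinuousLinearMap.adjoint_comp, ContinuousLinearMap.adjoint_adjoint] at h3
    ext u : 1
    have h4 := DFunLike.congr_fun h3 u
    simp only [ContinuousLinearMap.comp_apply] at h4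
    simp only [tensorVacuum, conjEmbed_apply, ContinuousLinearMap.comp_apply, mul_apply_eq_comp,
      ContinuousLinearMap.star_eq_adjoint]
    rw [h4]
    exact DFunLike.congr_fun h2 _
  rw [attenuator, partialTraceB]
  simp only [h1]
  -- At most `d - 1` photons can be lost, so the partial trace is a finite sum.
  rw [tsum_eq_sum (s := Finset.range (d + 2)), ← map_sum]
  · simp only [kraus_conj_eq A ht]
    rfl
  · intro q hq
    rw [Finset.mem_range, not_lt] at hq
    simp [kraus, loss_eq_zero (show d ≤ q by omega)]

end Attenuator

end

/-! ### The isoperimetric inequality on the Fock space. -/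

theorem theorem2 (ρ : ℓ²(ℕ, ℂ) →L[ℂ] ℓ²(ℕ, ℂ)) (hρ : Attenuator.IsState ρ)
    (hfin : Attenuator.HasFiniteSupport ρ) :
    (∀ t : ℝ, 0 ≤ t →
      Attenuator.vonNeumannEntropy (Attenuator.attenuator (Real.exp (-t)) ρ) ≠ ⊤) ∧
    ∃ D : EReal,
      Tendsto (fun t : ℝ => ((slope (fun s : ℝ => (Attenuator.vonNeumannEntropy
        (Attenuator.attenuator (Real.exp (-s)) ρ)).toReal) 0 t : ℝ) : EReal)) (𝓝[>] 0) (𝓝 D) ∧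
      ((Attenuator.f (Attenuator.vonNeumannEntropy ρ).toReal : ℝ) : EReal) ≤ D := by
  obtain ⟨d, A, hA, htr, rfl⟩ := Attenuator.exists_conjEmbed hρ hfin
  have hent : ∀ t : ℝ, 0 ≤ t → Attenuator.vonNeumannEntropy (Attenuator.attenuator (Real.exp (-t))
      (Attenuator.conjEmbed d A)) =
        ENNReal.ofReal (Attenuator.reTrace (cfc Real.negMulLog (Attenuator.evolution A t))) ∧
      0 ≤ Attenuator.reTrace (cfc Real.negMulLog (Attenuator.evolution A t)) := by
    intro t ht
    rw [Attenuator.attenuator_conjEmbed A ht]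
    exact Attenuator.vonNeumannEntropy_conjEmbed (Attenuator.isPositive_evolution hA ht)
      ((Attenuator.reTrace_evolution A t).trans htr)
  have hreal : ∀ t : ℝ, 0 ≤ t → (Attenuator.vonNeumannEntropy (Attenuator.attenuator
      (Real.exp (-t)) (Attenuator.conjEmbed d A))).toReal =
      Attenuator.reTrace (cfc Real.negMulLog (Attenuator.evolution A t)) := fun t ht => by
    rw [(hent t ht).1, ENNReal.toReal_ofReal (hent t ht).2]
  refine ⟨fun t ht => by rw [(hent t ht).1]; exact ENNReal.ofReal_ne_top, ?_⟩
  obtain ⟨D, hD, hfD⟩ := Attenuator.exists_tendsto_difference_quotient hA htr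
    (fun t ht => Attenuator.isPositive_evolution hA (le_of_lt ht))
    (Attenuator.isBigO_evolution A)
    (Attenuator.norm_star_loss_one_sq_le d)
  refine ⟨D, hD.congr' ?_, ?_⟩
  · filter_upwards [self_mem_nhdsWithin] with t ht
    rw [slope_def_field, hreal t (le_of_lt ht), hreal 0 le_rfl, Attenuator.evolution_zero, sub_zero]
  · obtain ⟨h1, h2⟩ := Attenuator.vonNeumannEntropy_conjEmbed hA htr
    rwa [h1, ENNReal.toReal_ofReal h2]
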